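/- Let $f$ be a smooth ($C^\infty$) real function on an open neighbourhood of the origin in $\mathbb R^2$ whose Taylor expansion at the origin is $$f(x,y)=x^2-a^2y^2+b_0x^3+b_1x^2y+b_2xy^2+b_3y^3+c_0x^4+c_1x^3y+c_2x^2y^2+c_3xy^3+c_4y^4+\cdots,\qquad a>0,$$ so that $z=f(x,y)$ is a surface with a hyperbolic point at the origin and tangent plane $z=0$ there. Let $f^{(n)}(s)$ denote the value at $(x,y)=(s,1)$ of the homogeneous part of degree $n$ of this expansion, and for $s=\pm a$ put $$L(s)=f^{(3)}(s)\bigl(b_0s^5-b_1s^4+(5b_0-3b_2)s^3-(5b_3-3b_1)s^2+b_2s-b_3\bigr)-4s^2(1+s^2)f^{(4)}(s).$$ ($L(a)=0$ and $L(-a)=0$ are the four-point contact conditions (VT1) and (VT2).) Let $$I_f=f_{xx}f_y^2-2f_{xy}f_xf_y+f_{yy}f_x^2,$$ $$\begin{aligned}V_f={}&(f_x^2+f_y^2)(-f_y^3f_{xxx}+3f_xf_y^2f_{xxy}-3f_x^2f_yf_{xyy}+f_x^3f_{yyy})\\&+3f_xf_y\bigl(f_y^2f_{xx}^2+(f_x^2-f_y^2)f_{xx}f_{yy}-f_x^2f_{yy}^2\bigr)+6f_xf_yf_{xy}^2(f_x^2-f_y^2)\\&+3f_{xy}\bigl(f_{xx}f_y^4-3f_x^2f_y^2(f_{xx}-f_{yy})-f_{yy}f_x^4\bigr),\end{aligned}$$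 whose zero sets are the loci of inflexions and of vertices of the level curves of $f$. Assume that we are in the case $\mathbf H_1$: for each of the two asymptotic directions $x=sy$, $s=\pm a$, the smooth branch of $f=0$ through the origin tangent to it has exactly 3-point contact (the minimum possible) with the branch of $V_f=0$ tangent to it, and exactly 2-point contact (the minimum possible) with the branch of $I_f=0$ tangent to it. (Two curves $x=\varphi(y)$ and $x=\psi(y)$ have exactly $n$-point contact at $y=0$ if the Taylor expansions of $\varphi$ and $\psi$ agree up to order $n-1$ and differ in order $n$.) A vertex of a nonsingular plane curve is a point where the derivative of its curvature along the curve vanishes, and an inflexion is a point where its curvature vanishes. A transition $m+n\leftrightarrow m'+n'$ of vertices (or inflexions) means the following. There is a sign $\sigma\in\{1,-1\}$ such that in every neighbourhood of the origin there is an open neighbourhood $U_0$ of the origin with this property: for every open neighbourhood $U\subseteq U_0$ of the origin there is $\varepsilon>0$ such that, for $0<k\le\varepsilon$, each of the level sets $f=\sigma k$ and $f=-\sigma k$ is nonsingular in $U_0$ and has exactly two branches (connected components) there; the parts in $U$ of the two branches of $f=\sigma k$ contain exactly $m$ and $n$ vertices (inflexions) respectively, in some order, and those of $f=-\sigma k$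 contain exactly $m'$ and $n'$, in some order. Then: (i) If $L(a)$ and $L(-a)$ have opposite signs, the vertex transition $2+2\leftrightarrow2+2$ occurs. (ii) If $L(a)$ and $L(-a)$ have the same (nonzero) sign, the vertex transition $1+1\leftrightarrow3+3$ occurs. (iia) If $L(a),L(-a)<0$ and $f^{(3)}(a)f^{(3)}(-a)>0$, or $L(a),L(-a)>0$ and $f^{(3)}(a)f^{(3)}(-a)<0$, then the vertex transition $1+1\leftrightarrow3+3$ is accompanied by the inflexion transition $1+1\leftrightarrow2+0$. (iib) If $L(a),L(-a)<0$ and $f^{(3)}(a)f^{(3)}(-a)<0$, or $L(a),L(-a)>0$ and $f^{(3)}(a)f^{(3)}(-a)>0$, then the vertex transition $1+1\leftrightarrow3+3$ is accompanied by the inflexion transition $2+0\leftrightarrow1+1$. In (iia) and (iib), "accompanied" means that both transitions hold with the same $\sigma$, $U_0$ and $\varepsilon$: for the sign of $k$ for which there are $1+1$ vertices the inflexions are those on the left of the arrow, and for the sign for which there are $3+3$ vertices they are those on the right. -/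

import Mathlib

open Set Filter Topology
open scoped ContDiff

namespace SurfaceSections

noncomputable section

/-- The partial derivative `∂g/∂x`. -/
def dX (g : ℝ × ℝ → ℝ) : ℝ × ℝ → ℝ := fun p => fderiv ℝ g p (1, 0)

/-- The partial derivative `∂g/∂y`. -/
def dY (g : ℝ × ℝ → ℝ) : ℝ × ℝ → ℝ := fun p => fderiv ℝ g p (0, 1)

/-- The coefficient of `x ^ i * y ^ j` in the Taylor expansion of `f` at the origin. -/
def taylorCoeff (f : ℝ × ℝ → ℝ) (i j : ℕ) : ℝ :=
  (dX^[i] (dY^[j] f)) (0, 0) / ((i.factorial : ℝ) * (j.factorial : ℝ))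

/-- The value at `(s, 1)` of the homogeneous part of degree `n` of the Taylor expansion of `f`. -/
def homPart (f : ℝ × ℝ → ℝ) (n : ℕ) (s : ℝ) : ℝ :=
  ∑ i ∈ Finset.range (n + 1), taylorCoeff f i (n - i) * s ^ i

/-- The Taylor expansion of `f` at the origin is `x ^ 2 - a ^ 2 * y ^ 2 + O(3)`, with `a > 0`:
the surface `z = f (x, y)` is in (scaled) Monge form at a hyperbolic point. -/
def IsHyperbolicMonge (f : ℝ × ℝ → ℝ) (a : ℝ) : Prop :=
  0 < a ∧ taylorCoeff f 0 0 = 0 ∧ taylorCoeff f 1 0 = 0 ∧ taylorCoeff f 0 1 = 0 ∧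
    taylorCoeff f 2 0 = 1 ∧ taylorCoeff f 1 1 = 0 ∧ taylorCoeff f 0 2 = -a ^ 2

/-- The left-hand side of the four-point contact condition for the branches tangent to `x = s * y`
(where `s = a` or `s = -a`). -/
def contactExpr (f : ℝ × ℝ → ℝ) (s : ℝ) : ℝ :=
  let b₀ := taylorCoeff f 3 0
  let b₁ := taylorCoeff f 2 1
  let b₂ := taylorCoeff f 1 2
  let b₃ := taylorCoeff f 0 3
  homPart f 3 s * (b₀ * s ^ 5 - b₁ * s ^ 4 + (5 * b₀ - 3 * b₂) * s ^ 3
      - (5 * b₃ - 3 * b₁) * s ^ 2 + b₂ * s - b₃)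
    - 4 * s ^ 2 * (1 + s ^ 2) * homPart f 4 s

/-! ### The vertex and inflexion functions and the case `H₁` -/

/-- The vertex function `V_f`. -/
def vertexFun (f : ℝ × ℝ → ℝ) (p : ℝ × ℝ) : ℝ :=
  let fx := dX f p
  let fy := dY f p
  let fxx := dX (dX f) p
  let fxy := dX (dY f) p
  let fyy := dY (dY f) p
  let fxxx := dX (dX (dX f)) p
  let fxxy := dX (dX (dY f)) p
  let fxyy := dX (dY (dY f)) p
  let fyyy := dY (dY (dY f)) p
  (fx ^ 2 + fy ^ 2) * (-fy ^ 3 * fxxx + 3 * fx * fy ^ 2 * fxxy - 3 * fx ^ 2 * fy * fxyy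
      + fx ^ 3 * fyyy)
    + 3 * fx * fy * (fy ^ 2 * fxx ^ 2 + (fx ^ 2 - fy ^ 2) * fxx * fyy - fx ^ 2 * fyy ^ 2)
    + 6 * fx * fy * fxy ^ 2 * (fx ^ 2 - fy ^ 2)
    + 3 * fxy * (fxx * fy ^ 4 - 3 * fx ^ 2 * fy ^ 2 * (fxx - fyy) - fyy * fx ^ 4)

/-- The inflexion function `I_f`. -/
def inflexionFun (f : ℝ × ℝ → ℝ) (p : ℝ × ℝ) : ℝ :=
  dX (dX f) p * dY f p ^ 2 - 2 * dX (dY f) p * dX f p * dY f p + dY (dY f) p * dX f p ^ 2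

/-- The curve `x = φ y` is a smooth branch at the origin of the set `g = 0`, tangent to
`x = s * y`. -/
def IsBranch (g : ℝ × ℝ → ℝ) (s : ℝ) (φ : ℝ → ℝ) : Prop :=
  ContDiffAt ℝ ∞ φ 0 ∧ φ 0 = 0 ∧ deriv φ 0 = s ∧ ∀ᶠ y in 𝓝 (0 : ℝ), g (φ y, y) = 0

/-- The curves `x = φ y` and `x = ψ y` have exactly `n`-point contact at `y = 0`. -/
def HasContact (n : ℕ) (φ ψ : ℝ → ℝ) : Prop :=
  (∀ j < n, iteratedDeriv j φ 0 = iteratedDeriv j ψ 0) ∧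
    iteratedDeriv n φ 0 ≠ iteratedDeriv n ψ 0

/-- The case `H₁`: for each of the two asymptotic directions `x = s * y`, `s = a` or `s = -a`, the
branch of `f = 0` tangent to it has exactly (the minimal) three-point contact with the branch of
`V_f = 0`, and exactly (the minimal) two-point contact with the branch of `I_f = 0`, tangent to it.
(At a hyperbolic point in Monge form, each of these branches exists and is unique as a germ.) -/
def CaseH₁ (f : ℝ × ℝ → ℝ) (a : ℝ) : Prop :=
  ∀ s : ℝ, s = a ∨ s = -a → ∀ φ : ℝ → ℝ, IsBranch f s φ →
    (∀ ψ : ℝ → ℝ, IsBranch (vertexFun f) s ψ → HasContact 3 φ ψ) ∧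
    (∀ χ : ℝ → ℝ, IsBranch (inflexionFun f) s χ → HasContact 2 φ χ)

/-! ### Vertices and inflexions of level curves -/

/-- The signed curvature `(x' y'' - y' x'') / (x' ^ 2 + y' ^ 2) ^ (3 / 2)` of the parametrized
plane curve `γ`. -/
def planeCurvature (γ : ℝ → ℝ × ℝ) (t : ℝ) : ℝ :=
  let x : ℝ → ℝ := fun u => (γ u).1
  let y : ℝ → ℝ := fun u => (γ u).2
  (deriv x t * deriv (deriv y) t - deriv y t * deriv (deriv x) t) /
    (deriv x t ^ 2 + deriv y t ^ 2) ^ (3 / 2 : ℝ)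

/-- `γ` is, near `t = 0`, a smooth regular parametrization of the level curve of `f` through `p`,
with `γ 0 = p`. -/
def IsLevelParam (f : ℝ × ℝ → ℝ) (p : ℝ × ℝ) (γ : ℝ → ℝ × ℝ) : Prop :=
  ContDiffAt ℝ ∞ γ 0 ∧ γ 0 = p ∧ deriv γ 0 ≠ 0 ∧ ∀ᶠ t in 𝓝 (0 : ℝ), f (γ t) = f p

/-- `p` is a vertex of the level curve of `f` through it: the level curve is nonsingular at `p` and
the derivative of its curvature vanishes there. (The condition does not depend on the
parametrization.) -/
def IsVertex (f : ℝ × ℝ → ℝ) (p : ℝ × ℝ) : Prop :=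
  fderiv ℝ f p ≠ 0 ∧ ∃ γ, IsLevelParam f p γ ∧ deriv (planeCurvature γ) 0 = 0

/-- `p` is an inflexion of the level curve of `f` through it: the level curve is nonsingular at `p`
and its curvature vanishes there. -/
def IsInflexion (f : ℝ × ℝ → ℝ) (p : ℝ × ℝ) : Prop :=
  fderiv ℝ f p ≠ 0 ∧ ∃ γ, IsLevelParam f p γ ∧ planeCurvature γ 0 = 0

/-! ### Transitions -/

/-- In the open set `U₀`, the level set `f = k` is nonsingular and has exactly two branches
(connected components), `C` and `D`. -/
def HasTwoBranches (f : ℝ × ℝ → ℝ) (U₀ : Set (ℝ × ℝ)) (k : ℝ) (C D : Set (ℝ × ℝ)) : Prop :=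
  (∀ p ∈ U₀, f p = k → fderiv ℝ f p ≠ 0) ∧ C ≠ D ∧
    {K | ∃ p ∈ {q ∈ U₀ | f q = k}, K = connectedComponentIn {q ∈ U₀ | f q = k} p} = {C, D}

/-- `X` contains exactly `m` and `Y` exactly `n` points with the property `P`. -/
def Counts (P : ℝ × ℝ → Prop) (m n : ℕ) (X Y : Set (ℝ × ℝ)) : Prop :=
  {p ∈ X | P p}.encard = m ∧ {p ∈ Y | P p}.encard = n

/-- The transition `A ↔ B` on the two branches of the level sets `f = k`, as `k` passes through `0`.
For one sign `σ` of `k` the pattern is `A`, for the other sign it is `B`: there are arbitrarily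
small open neighbourhoods `U₀` of the origin such that, for every open neighbourhood `U ⊆ U₀` of
the origin and all sufficiently small `k > 0`, the level set `f = σ * k` has exactly two branches
in `U₀`, whose parts in `U` are in pattern `A`, and likewise for `f = -σ * k` and `B`. -/
def Transition (f : ℝ × ℝ → ℝ) (A B : Set (ℝ × ℝ) → Set (ℝ × ℝ) → Prop) : Prop :=
  ∃ σ : ℝ, (σ = 1 ∨ σ = -1) ∧
    ∀ W ∈ 𝓝 ((0, 0) : ℝ × ℝ), ∃ U₀ ⊆ W, IsOpen U₀ ∧ (0, 0) ∈ U₀ ∧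
      ∀ U ⊆ U₀, IsOpen U → (0, 0) ∈ U → ∃ ε > 0, ∀ k : ℝ, 0 < k → k ≤ ε →
        (∃ C D, HasTwoBranches f U₀ (σ * k) C D ∧ A (C ∩ U) (D ∩ U)) ∧
        (∃ C D, HasTwoBranches f U₀ (-σ * k) C D ∧ B (C ∩ U) (D ∩ U))

/-- The vertex transition `m + n ↔ m' + n'`. -/
def VertexTransition (f : ℝ × ℝ → ℝ) (m n m' n' : ℕ) : Prop :=
  Transition f (Counts (IsVertex f) m n) (Counts (IsVertex f) m' n')

/-- The vertex transition `1 + 1 ↔ 3 + 3`, accompanied by the inflexion transition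
`m + n ↔ m' + n'`: for the sign of `k` for which there are `1 + 1` vertices there are `m + n`
inflexions, and for the sign for which there are `3 + 3` vertices there are `m' + n'`
inflexions. -/
def InflexionTransition (f : ℝ × ℝ → ℝ) (m n m' n' : ℕ) : Prop :=
  Transition f
    (fun X Y => Counts (IsVertex f) 1 1 X Y ∧ Counts (IsInflexion f) m n X Y)
    (fun X Y => Counts (IsVertex f) 3 3 X Y ∧ Counts (IsInflexion f) m' n' X Y)

end

end SurfaceSections

open SurfaceSections

open SurfaceSections

/-! Near the origin `f` is replaced by a globally smooth `g` with the same germ, and the saddle is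
blown up by `(x, t) ↦ (x, x * t)`. There `g = x ^ 2 * F` and `vertexFun g = x ^ 4 * W`, where `W (0,
t)` is a nonzero multiple of `t * (τ ^ 2 - t ^ 2)` and `±τ = ±1 / a` are the asymptotic slopes. The
three simple zeros give, by the implicit function theorem, three smooth branches of the vertex set:
one tangent to the `x`-axis and one tangent to each asymptotic direction. Similarly `inflexionFun g
= x ^ 2 * J`, where `J (0, t)` has the simple zeros `±τ` and gives two branches.

Along such a branch `g = x ^ (j + 2) * K` with `K` nonzero at the origin. On a short half-branch `g`
is therefore either strictly increasing from `0`, and takes each small value `k > 0` exactly once,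
or negative. For vertices, `j = 0` with `K > 0` on the first branch, and `j = 2` with `K` of the
sign of `L (±a)` on the other two. Since `j` is even, both halves of a branch behave alike: each
branch of `g = k` carries one vertex, plus one for every positive value among `L (a)`, `L (-a)`. For
inflexions `j = 1` and the sign of `K` comes from the cubic part, so that the two halves of a branch
behave oppositely.

Negative levels reduce to positive ones through `(x, y) ↦ -g (y, x)`, again a saddle, for which the
sign of `L` is reversed. The topology of the level curves comes from `g` being convex in `x` and
concave in `y`. Geometric vertices and inflexions are identified with the zeros of `vertexFun` and
`inflexionFun` by differentiating along a level curve.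

The main load is carried by `exists_blowup_expansion`, `exists_blowup_vertexFun`,
`exists_blowup_inflexionFun`, `IsBranchedChart.encard_eq`, `IsSaddleJet.eventually_level` and
`IsLevelParam.deriv_planeCurvature_eq_zero_iff`. -/

/-! ### Partial derivatives and Taylor expansion along lines through the origin. -/

theorem contDiff_dX {g : ℝ × ℝ → ℝ} (hg : ContDiff ℝ ∞ g) : ContDiff ℝ ∞ (dX g) :=
  (hg.fderiv_right (m := ∞) le_rfl).clm_apply contDiff_const

theorem contDiff_dY {g : ℝ × ℝ → ℝ} (hg : ContDiff ℝ ∞ g) : ContDiff ℝ ∞ (dY g) :=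
  (hg.fderiv_right (m := ∞) le_rfl).clm_apply contDiff_const

theorem contDiff_iterate_dX {g : ℝ × ℝ → ℝ} (hg : ContDiff ℝ ∞ g) (n : ℕ) :
    ContDiff ℝ ∞ (dX^[n] g) := by
  induction n with
  | zero => exact hg
  | succ n ih => rw [Function.iterate_succ_apply']; exact contDiff_dX ih

theorem contDiff_iterate_dY {g : ℝ × ℝ → ℝ} (hg : ContDiff ℝ ∞ g) (n : ℕ) :
    ContDiff ℝ ∞ (dY^[n] g) := by
  induction n with
  | zero => exact hg
  | succ n ih => rw [Function.iterate_succ_apply']; exact contDiff_dY ih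

theorem dY_dX {g : ℝ × ℝ → ℝ} (hg : ContDiff ℝ ∞ g) : dY (dX g) = dX (dY g) := by
  funext p
  have hd : DifferentiableAt ℝ (fderiv ℝ g) p :=
    (hg.fderiv_right (m := ∞) le_rfl).differentiable (by simp) p
  have hs : IsSymmSndFDerivAt ℝ g p := hg.contDiffAt.isSymmSndFDerivAt (by simpa using WithTop.coe_le_coe.2 (le_top (a := (2 : ℕ∞))))
  change fderiv ℝ (fun p => fderiv ℝ g p (1, 0)) p (0, 1) =
    fderiv ℝ (fun p => fderiv ℝ g p (0, 1)) p (1, 0)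
  rw [fderiv_clm_apply hd (by fun_prop), fderiv_clm_apply hd (by fun_prop)]
  simpa using hs.eq _ _

theorem iterate_dY_dX {g : ℝ × ℝ → ℝ} (hg : ContDiff ℝ ∞ g) (n : ℕ) :
    dY^[n] (dX g) = dX (dY^[n] g) := by
  induction n with
  | zero => rfl
  | succ n ih =>
    rw [Function.iterate_succ_apply', Function.iterate_succ_apply', ih,
      dY_dX (contDiff_iterate_dY hg n)]

theorem iterate_dY_iterate_dX {g : ℝ × ℝ → ℝ} (hg : ContDiff ℝ ∞ g) (m n : ℕ) :
    dY^[n] (dX^[m] g) = dX^[m] (dY^[n] g) := by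
  induction m with
  | zero => rfl
  | succ m ih =>
    rw [Function.iterate_succ_apply', Function.iterate_succ_apply',
      iterate_dY_dX (contDiff_iterate_dX hg m), ih]

theorem fderiv_eq_dX_dY (g : ℝ × ℝ → ℝ) (p v : ℝ × ℝ) :
    fderiv ℝ g p v = v.1 * dX g p + v.2 * dY g p := by
  have : v = v.1 • ((1, 0) : ℝ × ℝ) + v.2 • ((0, 1) : ℝ × ℝ) := by ext <;> simp
  conv_lhs => rw [this]
  rw [map_add, map_smul, map_smul]
  rfl

theorem hasDerivAt_comp_ray {h : ℝ × ℝ → ℝ} (hh : ContDiff ℝ ∞ h) (a b u : ℝ) :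
    HasDerivAt (fun u => h (u * a, u * b)) (a * dX h (u * a, u * b) + b * dY h (u * a, u * b)) u := by
  have h1 : HasFDerivAt h (fderiv ℝ h (u * a, u * b)) (u * a, u * b) :=
    (hh.differentiable (by simp) _).hasFDerivAt
  have h2 : HasDerivAt (fun u : ℝ => (u * a, u * b)) (a, b) u := by
    simpa using ((hasDerivAt_id u).mul_const a).prodMk ((hasDerivAt_id u).mul_const b)
  have := h1.comp_hasDerivAt u h2
  rwa [fderiv_eq_dX_dY] at this

/-- The `n`-th directional derivative in the direction `(a, b)`, by the binomial theorem. -/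
noncomputable def binomDeriv (h : ℝ × ℝ → ℝ) (n : ℕ) (a b : ℝ) (p : ℝ × ℝ) : ℝ :=
  ∑ ij ∈ Finset.HasAntidiagonal.antidiagonal n,
    (n.choose ij.1 : ℝ) * (b ^ ij.1 * a ^ ij.2 * (dX^[ij.2] (dY^[ij.1] h)) p)

/-- Induction on the order: one differentiation along the ray produces the two first partials, and
Pascal's rule, in antidiagonal form, recombines their expansions. -/
theorem iteratedDeriv_comp_ray (n : ℕ) (a b : ℝ) : ∀ {h : ℝ × ℝ → ℝ}, ContDiff ℝ ∞ h →
    iteratedDeriv n (fun u => h (u * a, u * b)) = fun u => binomDeriv h n a b (u * a, u * b) := by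
  induction n with
  | zero => intro h hh; funext u; simp [binomDeriv]
  | succ n ih =>
    intro h hh
    have hd : deriv (fun u => h (u * a, u * b)) =
        fun u => a * dX h (u * a, u * b) + b * dY h (u * a, u * b) := by
      funext u; exact (hasDerivAt_comp_ray hh a b u).deriv
    have hl : ContDiff ℝ ∞ (fun u : ℝ => (u * a, u * b)) := by fun_prop
    have hx := ((contDiff_dX hh).comp hl).of_le (m := n) (by exact_mod_cast le_top)
    have hy := ((contDiff_dY hh).comp hl).of_le (m := n) (by exact_mod_cast le_top)
    funext u
    rw [iteratedDeriv_succ', hd]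
    have e1 := congrFun (ih (contDiff_dX hh)) u
    have e2 := congrFun (ih (contDiff_dY hh)) u
    have : iteratedDeriv n (fun u => a * dX h (u * a, u * b) + b * dY h (u * a, u * b)) u =
        a * binomDeriv (dX h) n a b (u * a, u * b) + b * binomDeriv (dY h) n a b (u * a, u * b) := by
      rw [← e1, ← e2]
      have := iteratedDeriv_fun_add (n := n) (x := u)
        (f := fun u => a * dX h (u * a, u * b)) (g := fun u => b * dY h (u * a, u * b))
        (contDiff_const.mul hx).contDiffAt (contDiff_const.mul hy).contDiffAt
      rw [this, iteratedDeriv_const_mul_field, iteratedDeriv_const_mul_field]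
    rw [this]
    unfold binomDeriv
    rw [Finset.sum_antidiagonal_choose_succ_mul
      (fun i j => b ^ i * a ^ j * (dX^[j] (dY^[i] h)) (u * a, u * b)), Finset.mul_sum, Finset.mul_sum]
    congr 1
    · refine Finset.sum_congr rfl fun ij _ => ?_
      rw [iterate_dY_dX hh, ← Function.iterate_succ_apply]
      ring
    · refine Finset.sum_congr rfl fun ij hij => ?_
      rw [← Function.iterate_succ_apply dY, Nat.choose_symm_of_eq_add
        (by rw [← Finset.HasAntidiagonal.mem_antidiagonal.1 hij])]
      simp only [Nat.succ_eq_add_one]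
      ring

/-- Differentiation under the integral sign, dominated by a bound on a compact ball times `[0, 1]`.
It makes the integral remainder of Taylor's formula `C¹`, which the implicit function theorem needs
later. -/
theorem contDiff_integral_parametric {E : Type*} [NormedAddCommGroup E] [NormedSpace ℝ E] [FiniteDimensional ℝ E]
    {h : E × ℝ → ℝ} (hh : ContDiff ℝ 1 h) :
    ContDiff ℝ 1 (fun q => ∫ u in (0 : ℝ)..1, h (q, u)) := by
  have hc : Continuous fun p : E × ℝ => (fderiv ℝ h p).comp (ContinuousLinearMap.inl ℝ E ℝ) :=
    (hh.continuous_fderiv (by simp)).clm_comp continuous_const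
  have hd : ∀ q, HasFDerivAt (fun q => ∫ u in (0 : ℝ)..1, h (q, u))
      (∫ u in (0 : ℝ)..1, (fderiv ℝ h (q, u)).comp (ContinuousLinearMap.inl ℝ E ℝ)) q := by
    intro q
    obtain ⟨C, hC⟩ := ((isCompact_closedBall q 1).prod (isCompact_Icc (a := (0:ℝ)) (b := 1))
      ).exists_bound_of_continuousOn hc.continuousOn
    refine intervalIntegral.hasFDerivAt_integral_of_dominated_of_fderiv_le
      (F := fun q u => h (q, u)) (F' := fun q u => (fderiv ℝ h (q, u)).comp (ContinuousLinearMap.inl ℝ E ℝ))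
      (bound := fun _ => C) (Metric.ball_mem_nhds q one_pos) ?_ ?_ ?_ ?_ ?_ ?_
    · refine Eventually.of_forall fun q => Continuous.aestronglyMeasurable ?_
      exact hh.continuous.comp (by fun_prop)
    · exact Continuous.intervalIntegrable (hh.continuous.comp (by fun_prop)) _ _
    · exact Continuous.aestronglyMeasurable (hc.comp (by fun_prop))
    · refine Eventually.of_forall fun u hu q' hq' => hC (q', u) ⟨Metric.ball_subset_closedBall hq', ?_⟩
      rw [uIoc_of_le zero_le_one] at hu
      exact ⟨hu.1.le, hu.2⟩
    · exact intervalIntegrable_const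
    · refine Eventually.of_forall fun u _ q' _ => ?_
      have h1 : HasFDerivAt h (fderiv ℝ h (q', u)) (q', u) :=
        (hh.differentiable (by simp) _).hasFDerivAt
      exact h1.comp q' (hasFDerivAt_prodMk_left q' u)
  rw [contDiff_one_iff_fderiv]
  refine ⟨fun q => (hd q).differentiableAt, ?_⟩
  have : fderiv ℝ (fun q => ∫ u in (0 : ℝ)..1, h (q, u)) = fun q =>
      ∫ u in (0 : ℝ)..1, (fderiv ℝ h (q, u)).comp (ContinuousLinearMap.inl ℝ E ℝ) := by
    funext q; exact (hd q).fderiv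
  rw [this]
  exact intervalIntegral.continuous_parametric_intervalIntegral_of_continuous' (by exact hc) 0 1

/-- Taylor expansion along the lines through the origin, with a `C¹` remainder. -/
theorem exists_blowup_expansion {h : ℝ × ℝ → ℝ} (hh : ContDiff ℝ ∞ h) (n : ℕ) :
    ∃ ρ : ℝ × ℝ → ℝ, ContDiff ℝ 1 ρ ∧ ∀ x t, h (x, x * t) =
      ∑ i ∈ Finset.range (n + 1), x ^ i * (binomDeriv h i 1 t (0, 0) / (i.factorial : ℝ))
        + x ^ (n + 1) * ρ (x, t) := by
  have hb : ∀ (i : ℕ), ContDiff ℝ 1 fun q : (ℝ × ℝ) × ℝ => binomDeriv h i 1 q.1.2 (q.2 * q.1.1, q.2 * (q.1.1 * q.1.2)) := by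
    intro i
    unfold binomDeriv
    refine ContDiff.sum fun ij _ => ?_
    have : ContDiff ℝ 1 fun q : (ℝ × ℝ) × ℝ => (dX^[ij.2] (dY^[ij.1] h)) (q.2 * q.1.1, q.2 * (q.1.1 * q.1.2)) :=
      ((contDiff_iterate_dX (contDiff_iterate_dY hh _) _).of_le (by exact_mod_cast le_top)).comp (by fun_prop)
    fun_prop
  -- Homogeneity in the direction: the powers of `x` come out of the derivatives exactly, so the
  -- remainder can be divided by `x ^ (n + 1)` with no singularity at `x = 0`.
  have hs : ∀ (i : ℕ) (x t : ℝ) p, binomDeriv h i x (x * t) p = x ^ i * binomDeriv h i 1 t p := by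
    intro i x t p
    unfold binomDeriv
    rw [Finset.mul_sum]
    refine Finset.sum_congr rfl fun ij hij => ?_
    rw [← Finset.HasAntidiagonal.mem_antidiagonal.1 hij, pow_add]
    ring
  -- The integral form of the remainder of `u ↦ h (u * x, u * (x * t))` on `[0, 1]`, with `x ^ (n +
  -- 1)` removed.
  refine ⟨fun q : ℝ × ℝ => ∫ u in (0 : ℝ)..1, ((1 - u) ^ n / (n.factorial : ℝ)) *
      binomDeriv h (n + 1) 1 q.2 (u * q.1, u * (q.1 * q.2)), ?_, ?_⟩
  · refine contDiff_integral_parametric (E := ℝ × ℝ) (h := fun q => ((1 - q.2) ^ n / (n.factorial : ℝ)) *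
      binomDeriv h (n + 1) 1 q.1.2 (q.2 * q.1.1, q.2 * (q.1.1 * q.1.2))) ?_
    have := hb (n + 1)
    fun_prop
  · intro x t
    have hψ : ContDiff ℝ ∞ (fun u : ℝ => h (u * x, u * (x * t))) := hh.comp (by fun_prop)
    have hI : ∀ i, EqOn (iteratedDerivWithin i (fun u : ℝ => h (u * x, u * (x * t))) (uIcc 0 1))
        (fun u => x ^ i * binomDeriv h i 1 t (u * x, u * (x * t))) (uIcc 0 1) := by
      intro i u hu
      rw [iteratedDerivWithin_eq_iteratedDeriv (uniqueDiffOn_uIcc zero_ne_one)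
        ((hψ.of_le (by exact_mod_cast le_top)).contDiffAt) hu, iteratedDeriv_comp_ray i _ _ hh]
      exact hs _ _ _ _
    have key := taylor_integral_remainder (f := fun u : ℝ => h (u * x, u * (x * t))) (x := 1)
      (x₀ := 0) (n := n) (hψ.of_le (by exact_mod_cast le_top)).contDiffOn
    rw [sub_eq_iff_eq_add', taylor_within_apply] at key
    simp only [one_mul] at key
    rw [key]
    congr 1
    · refine Finset.sum_congr rfl fun i _ => ?_
      rw [hI i left_mem_uIcc]
      simp
      ring
    · rw [← intervalIntegral.integral_const_mul]
      refine intervalIntegral.integral_congr fun u hu => ?_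
      simp only
      rw [hI (n + 1) hu]
      simp only [smul_eq_mul]
      ring

/-! ### Second-order jets in the blow-up coordinate. -/

/-- `h (x, t) = a t + x * b t + x ^ 2 * c t + O(x ^ 3)`, with a `C¹` remainder. -/
def HasJet (h : ℝ × ℝ → ℝ) (a b c : ℝ → ℝ) : Prop :=
  ContDiff ℝ 1 a ∧ ContDiff ℝ 1 b ∧ ContDiff ℝ 1 c ∧ ∃ ρ : ℝ × ℝ → ℝ, ContDiff ℝ 1 ρ ∧
    ∀ x t, h (x, t) = a t + x * b t + x ^ 2 * c t + x ^ 3 * ρ (x, t)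

namespace HasJet

variable {h k : ℝ × ℝ → ℝ} {a b c a' b' c' : ℝ → ℝ}

theorem contDiff (H : HasJet h a b c) : ContDiff ℝ 1 h := by
  obtain ⟨ha, hb, hc, ρ, hρ, e⟩ := H
  have : h = fun q => a q.2 + q.1 * b q.2 + q.1 ^ 2 * c q.2 + q.1 ^ 3 * ρ q := by
    funext ⟨x, t⟩; exact e x t
  rw [this]
  fun_prop

theorem apply_zero (H : HasJet h a b c) (t : ℝ) : h (0, t) = a t := by
  obtain ⟨-, -, -, ρ, -, e⟩ := H
  simp [e]

theorem congr_coeff (H : HasJet h a b c) (h0 : ∀ t, a t = a' t) (h1 : ∀ t, b t = b' t)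
    (h2 : ∀ t, c t = c' t) : HasJet h a' b' c' := by
  rwa [← funext h0, ← funext h1, ← funext h2]

theorem add (H : HasJet h a b c) (K : HasJet k a' b' c') :
    HasJet (fun q => h q + k q) (fun t => a t + a' t) (fun t => b t + b' t)
      (fun t => c t + c' t) := by
  obtain ⟨ha, hb, hc, ρ, hρ, e⟩ := H
  obtain ⟨ha', hb', hc', ρ', hρ', e'⟩ := K
  refine ⟨by fun_prop, by fun_prop, by fun_prop, fun q => ρ q + ρ' q, by fun_prop, fun x t => ?_⟩
  simp only [e, e']
  ring

theorem mul (H : HasJet h a b c) (K : HasJet k a' b' c') :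
    HasJet (fun q => h q * k q) (fun t => a t * a' t) (fun t => a t * b' t + b t * a' t)
      (fun t => a t * c' t + b t * b' t + c t * a' t) := by
  obtain ⟨ha, hb, hc, ρ, hρ, e⟩ := H
  obtain ⟨ha', hb', hc', ρ', hρ', e'⟩ := K
  refine ⟨by fun_prop, by fun_prop, by fun_prop, fun q => a q.2 * ρ' q + ρ q * a' q.2 +
    b q.2 * c' q.2 + c q.2 * b' q.2 + q.1 * (b q.2 * ρ' q + ρ q * b' q.2 + c q.2 * c' q.2) +
    q.1 ^ 2 * (c q.2 * ρ' q + ρ q * c' q.2) + q.1 ^ 3 * (ρ q * ρ' q), by fun_prop, fun x t => ?_⟩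
  simp only [e, e']
  ring

theorem const_mul (H : HasJet h a b c) (r : ℝ) :
    HasJet (fun q => r * h q) (fun t => r * a t) (fun t => r * b t) (fun t => r * c t) := by
  obtain ⟨ha, hb, hc, ρ, hρ, e⟩ := H
  refine ⟨by fun_prop, by fun_prop, by fun_prop, fun q => r * ρ q, by fun_prop, fun x t => ?_⟩
  simp only [e]
  ring

theorem neg (H : HasJet h a b c) :
    HasJet (fun q => -h q) (fun t => -a t) (fun t => -b t) (fun t => -c t) := by
  simpa using H.const_mul (-1)

theorem sub (H : HasJet h a b c) (K : HasJet k a' b' c') :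
    HasJet (fun q => h q - k q) (fun t => a t - a' t) (fun t => b t - b' t)
      (fun t => c t - c' t) := by
  simpa only [sub_eq_add_neg] using H.add K.neg

end HasJet

theorem contDiff_binomDeriv (h : ℝ × ℝ → ℝ) (i : ℕ) (p : ℝ × ℝ) :
    ContDiff ℝ 1 fun t => binomDeriv h i 1 t p := by
  unfold binomDeriv
  fun_prop

theorem binomDeriv_zero (h : ℝ × ℝ → ℝ) (a b : ℝ) (p : ℝ × ℝ) : binomDeriv h 0 a b p = h p := by
  simp [binomDeriv]

section Expansions

variable {h : ℝ × ℝ → ℝ}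

theorem hasJet_blowup (hh : ContDiff ℝ ∞ h) :
    HasJet (fun q => h (q.1, q.1 * q.2)) (fun t => binomDeriv h 0 1 t (0, 0))
      (fun t => binomDeriv h 1 1 t (0, 0)) (fun t => binomDeriv h 2 1 t (0, 0) / 2) := by
  obtain ⟨ρ, hρ, e⟩ := exists_blowup_expansion hh 2
  refine ⟨contDiff_binomDeriv .., contDiff_binomDeriv .., (contDiff_binomDeriv ..).div_const _,
    ρ, hρ, fun x t => ?_⟩
  simp only [e]
  simp [Finset.sum_range_succ, Nat.factorial]

/-- Third derivatives enter the vertex function with one more factor of first derivatives than the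
other terms, so after division by `x ^ 4` they carry a factor `x`. -/
theorem hasJet_mul_blowup (hh : ContDiff ℝ ∞ h) :
    HasJet (fun q => q.1 * h (q.1, q.1 * q.2)) (fun _ => 0)
      (fun t => binomDeriv h 0 1 t (0, 0)) (fun t => binomDeriv h 1 1 t (0, 0)) := by
  obtain ⟨ρ, hρ, e⟩ := exists_blowup_expansion hh 1
  refine ⟨contDiff_const, contDiff_binomDeriv .., contDiff_binomDeriv .., ρ, hρ, fun x t => ?_⟩
  simp only [e]
  simp [Finset.sum_range_succ, Nat.factorial]
  ring

theorem exists_hasJet_blowup_div (hh : ContDiff ℝ ∞ h) (h0 : h (0, 0) = 0) :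
    ∃ E : ℝ × ℝ → ℝ, (∀ x t, h (x, x * t) = x * E (x, t)) ∧
      HasJet E (fun t => binomDeriv h 1 1 t (0, 0)) (fun t => binomDeriv h 2 1 t (0, 0) / 2)
        (fun t => binomDeriv h 3 1 t (0, 0) / 6) := by
  obtain ⟨ρ, hρ, e⟩ := exists_blowup_expansion hh 3
  refine ⟨fun q => binomDeriv h 1 1 q.2 (0, 0) + q.1 * (binomDeriv h 2 1 q.2 (0, 0) / 2) +
    q.1 ^ 2 * (binomDeriv h 3 1 q.2 (0, 0) / 6) + q.1 ^ 3 * ρ q, fun x t => ?_,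
    contDiff_binomDeriv .., (contDiff_binomDeriv ..).div_const _,
    (contDiff_binomDeriv ..).div_const _, ρ, hρ, fun x t => rfl⟩
  rw [e]
  simp [Finset.sum_range_succ, Nat.factorial, binomDeriv_zero, h0]
  ring

theorem exists_hasJet_blowup_div_sq (hh : ContDiff ℝ ∞ h) (h0 : h (0, 0) = 0)
    (h1 : ∀ t, binomDeriv h 1 1 t (0, 0) = 0) :
    ∃ E : ℝ × ℝ → ℝ, (∀ x t, h (x, x * t) = x ^ 2 * E (x, t)) ∧
      HasJet E (fun t => binomDeriv h 2 1 t (0, 0) / 2) (fun t => binomDeriv h 3 1 t (0, 0) / 6)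
        (fun t => binomDeriv h 4 1 t (0, 0) / 24) := by
  obtain ⟨ρ, hρ, e⟩ := exists_blowup_expansion hh 4
  refine ⟨fun q => binomDeriv h 2 1 q.2 (0, 0) / 2 + q.1 * (binomDeriv h 3 1 q.2 (0, 0) / 6) +
    q.1 ^ 2 * (binomDeriv h 4 1 q.2 (0, 0) / 24) + q.1 ^ 3 * ρ q, fun x t => ?_,
    (contDiff_binomDeriv ..).div_const _, (contDiff_binomDeriv ..).div_const _,
    (contDiff_binomDeriv ..).div_const _, ρ, hρ, fun x t => rfl⟩
  rw [e]
  simp [Finset.sum_range_succ, Nat.factorial, binomDeriv_zero, h0, h1]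
  ring

end Expansions

/-- Turns the expansion of any partial derivative into Taylor coefficients of `f`, which makes the
jets below finite computations. -/
theorem binomDeriv_iterate {f : ℝ × ℝ → ℝ} (hf : ContDiff ℝ ∞ f) (p q i : ℕ) (t : ℝ) :
    binomDeriv (dX^[p] (dY^[q] f)) i 1 t (0, 0) =
      ∑ ij ∈ Finset.HasAntidiagonal.antidiagonal i, (i.choose ij.1 : ℝ) * (t ^ ij.1 *
        (taylorCoeff f (p + ij.2) (q + ij.1) *
          (((p + ij.2).factorial : ℝ) * ((q + ij.1).factorial : ℝ)))) := by
  unfold binomDeriv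
  refine Finset.sum_congr rfl fun ij _ => ?_
  rw [taylorCoeff, div_mul_cancel₀ _ (by positivity), iterate_dY_iterate_dX (contDiff_iterate_dY hf _),
    ← Function.iterate_add_apply, ← Function.iterate_add_apply, add_comm p, add_comm q]
  simp

/-- The vertex function in terms of the partial derivatives. -/
theorem vertexFun_eq (f : ℝ × ℝ → ℝ) (p : ℝ × ℝ) : vertexFun f p =
    (dX f p * dX f p + dY f p * dY f p) *
      (-(dY f p * (dY f p * dY f p) * dX (dX (dX f)) p)
        + 3 * (dX f p * (dY f p * dY f p) * dX (dX (dY f)) p)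
        - 3 * (dX f p * dX f p * dY f p * dX (dY (dY f)) p)
        + dX f p * (dX f p * dX f p) * dY (dY (dY f)) p)
    + (3 * (dX f p * dY f p * (dY f p * dY f p * (dX (dX f) p * dX (dX f) p)
          + (dX f p * dX f p - dY f p * dY f p) * (dX (dX f) p * dY (dY f) p)
          - dX f p * dX f p * (dY (dY f) p * dY (dY f) p)))
      + 6 * (dX f p * dY f p * (dX (dY f) p * dX (dY f) p) *
          (dX f p * dX f p - dY f p * dY f p))
      + 3 * (dX (dY f) p * (dX (dX f) p * (dY f p * dY f p * (dY f p * dY f p))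
          - 3 * (dX f p * dX f p * (dY f p * dY f p) * (dX (dX f) p - dY (dY f) p))
          - dY (dY f) p * (dX f p * dX f p * (dX f p * dX f p))))) := by
  simp only [vertexFun]
  ring

/-! ### Jets of a saddle and of its derivatives. -/

/-- The function `g` vanishes at the origin and has the `2`-jet `β * (τ ^ 2 * x ^ 2 - y ^ 2)`. -/
structure IsSaddleJet (g : ℝ × ℝ → ℝ) (β τ : ℝ) : Prop where
  contDiff : ContDiff ℝ ∞ g
  c00 : taylorCoeff g 0 0 = 0
  c10 : taylorCoeff g 1 0 = 0
  c01 : taylorCoeff g 0 1 = 0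
  c20 : taylorCoeff g 2 0 = β * τ ^ 2
  c11 : taylorCoeff g 1 1 = 0
  c02 : taylorCoeff g 0 2 = -β

namespace IsSaddleJet

variable {g : ℝ × ℝ → ℝ} {β τ : ℝ}

theorem exists_blowup_self (H : IsSaddleJet g β τ) : ∃ F : ℝ × ℝ → ℝ,
    (∀ x t, g (x, x * t) = x ^ 2 * F (x, t)) ∧
    HasJet F (fun t => β * (τ ^ 2 - t ^ 2))
      (fun t => taylorCoeff g 3 0 + taylorCoeff g 2 1 * t + taylorCoeff g 1 2 * t ^ 2 +
        taylorCoeff g 0 3 * t ^ 3)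
      (fun t => taylorCoeff g 4 0 + taylorCoeff g 3 1 * t + taylorCoeff g 2 2 * t ^ 2 +
        taylorCoeff g 1 3 * t ^ 3 + taylorCoeff g 0 4 * t ^ 4) := by
  have hb := binomDeriv_iterate H.contDiff 0 0
  simp only [Function.iterate_zero, id_eq] at hb
  obtain ⟨F, hF, hJ⟩ := exists_hasJet_blowup_div_sq H.contDiff
    (by simpa [taylorCoeff] using H.c00)
    (fun t => by rw [hb]; simp [Finset.Nat.antidiagonal_succ, H.c10, H.c01])
  refine ⟨F, hF, hJ.congr_coeff (fun t => ?_) (fun t => ?_) (fun t => ?_)⟩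
  · rw [hb]; simp [Finset.Nat.antidiagonal_succ, H.c20, H.c11, H.c02, Nat.factorial]; ring
  · rw [hb]; simp [Finset.Nat.antidiagonal_succ, Nat.factorial, Nat.choose]; ring
  · rw [hb]; simp [Finset.Nat.antidiagonal_succ, Nat.factorial, Nat.choose]; ring

theorem exists_blowup_dX (H : IsSaddleJet g β τ) : ∃ A : ℝ × ℝ → ℝ,
    (∀ x t, dX g (x, x * t) = x * A (x, t)) ∧
    HasJet A (fun _ => 2 * (β * τ ^ 2))
      (fun t => 3 * taylorCoeff g 3 0 + 2 * taylorCoeff g 2 1 * t + taylorCoeff g 1 2 * t ^ 2)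
      (fun t => 4 * taylorCoeff g 4 0 + 3 * taylorCoeff g 3 1 * t + 2 * taylorCoeff g 2 2 * t ^ 2 +
        taylorCoeff g 1 3 * t ^ 3) := by
  have hb := binomDeriv_iterate H.contDiff 1 0
  simp only [Function.iterate_zero, Function.iterate_one, id_eq] at hb
  obtain ⟨F, hF, hJ⟩ := exists_hasJet_blowup_div (contDiff_dX H.contDiff)
    (by simpa [taylorCoeff] using H.c10)
  refine ⟨F, hF, hJ.congr_coeff (fun t => ?_) (fun t => ?_) (fun t => ?_)⟩
  · rw [hb]; simp [Finset.Nat.antidiagonal_succ, H.c20, H.c11, Nat.factorial]; ring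
  · rw [hb]; simp [Finset.Nat.antidiagonal_succ, Nat.factorial, Nat.choose]; ring
  · rw [hb]; simp [Finset.Nat.antidiagonal_succ, Nat.factorial, Nat.choose]; ring

theorem exists_blowup_dY (H : IsSaddleJet g β τ) : ∃ B : ℝ × ℝ → ℝ,
    (∀ x t, dY g (x, x * t) = x * B (x, t)) ∧
    HasJet B (fun t => -2 * β * t)
      (fun t => taylorCoeff g 2 1 + 2 * taylorCoeff g 1 2 * t + 3 * taylorCoeff g 0 3 * t ^ 2)
      (fun t => taylorCoeff g 3 1 + 2 * taylorCoeff g 2 2 * t + 3 * taylorCoeff g 1 3 * t ^ 2 +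
        4 * taylorCoeff g 0 4 * t ^ 3) := by
  have hb := binomDeriv_iterate H.contDiff 0 1
  simp only [Function.iterate_zero, Function.iterate_one, id_eq] at hb
  obtain ⟨F, hF, hJ⟩ := exists_hasJet_blowup_div (contDiff_dY H.contDiff)
    (by simpa [taylorCoeff] using H.c01)
  refine ⟨F, hF, hJ.congr_coeff (fun t => ?_) (fun t => ?_) (fun t => ?_)⟩
  · rw [hb]; simp [Finset.Nat.antidiagonal_succ, H.c11, H.c02, Nat.factorial]; ring
  · rw [hb]; simp [Finset.Nat.antidiagonal_succ, Nat.factorial, Nat.choose]; ring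
  · rw [hb]; simp [Finset.Nat.antidiagonal_succ, Nat.factorial, Nat.choose]; ring

theorem hasJet_dX_dX (H : IsSaddleJet g β τ) :
    HasJet (fun q => dX (dX g) (q.1, q.1 * q.2)) (fun _ => 2 * (β * τ ^ 2))
      (fun t => 6 * taylorCoeff g 3 0 + 2 * taylorCoeff g 2 1 * t)
      (fun t => 12 * taylorCoeff g 4 0 + 6 * taylorCoeff g 3 1 * t +
        2 * taylorCoeff g 2 2 * t ^ 2) := by
  have hb := binomDeriv_iterate H.contDiff 2 0
  simp only [Function.iterate_zero, Function.iterate_succ, Function.comp_apply, id_eq] at hb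
  refine (hasJet_blowup (contDiff_dX (contDiff_dX H.contDiff))).congr_coeff
    (fun t => ?_) (fun t => ?_) (fun t => ?_)
  · rw [hb]; simp [H.c20, Nat.factorial]; ring
  · rw [hb]; simp [Finset.Nat.antidiagonal_succ, Nat.factorial]; ring
  · rw [hb]; simp [Finset.Nat.antidiagonal_succ, Nat.factorial]; ring

theorem hasJet_dX_dY (H : IsSaddleJet g β τ) :
    HasJet (fun q => dX (dY g) (q.1, q.1 * q.2)) (fun _ => 0)
      (fun t => 2 * taylorCoeff g 2 1 + 2 * taylorCoeff g 1 2 * t)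
      (fun t => 3 * taylorCoeff g 3 1 + 4 * taylorCoeff g 2 2 * t +
        3 * taylorCoeff g 1 3 * t ^ 2) := by
  have hb := binomDeriv_iterate H.contDiff 1 1
  simp only [Function.iterate_one] at hb
  refine (hasJet_blowup (contDiff_dX (contDiff_dY H.contDiff))).congr_coeff
    (fun t => ?_) (fun t => ?_) (fun t => ?_)
  · rw [hb]; simp [H.c11, Nat.factorial]
  · rw [hb]; simp [Finset.Nat.antidiagonal_succ, Nat.factorial]; ring
  · rw [hb]; simp [Finset.Nat.antidiagonal_succ, Nat.factorial]; ring

theorem hasJet_dY_dY (H : IsSaddleJet g β τ) :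
    HasJet (fun q => dY (dY g) (q.1, q.1 * q.2)) (fun _ => -2 * β)
      (fun t => 2 * taylorCoeff g 1 2 + 6 * taylorCoeff g 0 3 * t)
      (fun t => 2 * taylorCoeff g 2 2 + 6 * taylorCoeff g 1 3 * t +
        12 * taylorCoeff g 0 4 * t ^ 2) := by
  have hb := binomDeriv_iterate H.contDiff 0 2
  simp only [Function.iterate_zero, Function.iterate_succ, Function.comp_apply, id_eq] at hb
  refine (hasJet_blowup (contDiff_dY (contDiff_dY H.contDiff))).congr_coeff
    (fun t => ?_) (fun t => ?_) (fun t => ?_)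
  · rw [hb]; simp [H.c02, Nat.factorial]; ring
  · rw [hb]; simp [Finset.Nat.antidiagonal_succ, Nat.factorial]; ring
  · rw [hb]; simp [Finset.Nat.antidiagonal_succ, Nat.factorial]; ring

theorem hasJet_mul_dX_dX_dX (H : IsSaddleJet g β τ) :
    HasJet (fun q => q.1 * dX (dX (dX g)) (q.1, q.1 * q.2)) (fun _ => 0)
      (fun _ => 6 * taylorCoeff g 3 0)
      (fun t => 24 * taylorCoeff g 4 0 + 6 * taylorCoeff g 3 1 * t) := by
  have hb := binomDeriv_iterate H.contDiff 3 0
  simp only [Function.iterate_zero, Function.iterate_succ, Function.comp_apply, id_eq] at hb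
  refine (hasJet_mul_blowup (contDiff_dX (contDiff_dX (contDiff_dX H.contDiff)))).congr_coeff
    (fun t => rfl) (fun t => ?_) (fun t => ?_)
  · rw [hb]; simp [Nat.factorial]; ring
  · rw [hb]; simp [Finset.Nat.antidiagonal_succ, Nat.factorial]; ring

theorem hasJet_mul_dX_dX_dY (H : IsSaddleJet g β τ) :
    HasJet (fun q => q.1 * dX (dX (dY g)) (q.1, q.1 * q.2)) (fun _ => 0)
      (fun _ => 2 * taylorCoeff g 2 1)
      (fun t => 6 * taylorCoeff g 3 1 + 4 * taylorCoeff g 2 2 * t) := by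
  have hb := binomDeriv_iterate H.contDiff 2 1
  simp only [Function.iterate_zero, Function.iterate_succ, Function.comp_apply, id_eq] at hb
  refine (hasJet_mul_blowup (contDiff_dX (contDiff_dX (contDiff_dY H.contDiff)))).congr_coeff
    (fun t => rfl) (fun t => ?_) (fun t => ?_)
  · rw [hb]; simp [Nat.factorial]; ring
  · rw [hb]; simp [Finset.Nat.antidiagonal_succ, Nat.factorial]; ring

theorem hasJet_mul_dX_dY_dY (H : IsSaddleJet g β τ) :
    HasJet (fun q => q.1 * dX (dY (dY g)) (q.1, q.1 * q.2)) (fun _ => 0)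
      (fun _ => 2 * taylorCoeff g 1 2)
      (fun t => 4 * taylorCoeff g 2 2 + 6 * taylorCoeff g 1 3 * t) := by
  have hb := binomDeriv_iterate H.contDiff 1 2
  simp only [Function.iterate_zero, Function.iterate_succ, Function.comp_apply, id_eq] at hb
  refine (hasJet_mul_blowup (contDiff_dX (contDiff_dY (contDiff_dY H.contDiff)))).congr_coeff
    (fun t => rfl) (fun t => ?_) (fun t => ?_)
  · rw [hb]; simp [Nat.factorial]; ring
  · rw [hb]; simp [Finset.Nat.antidiagonal_succ, Nat.factorial]; ring

theorem hasJet_mul_dY_dY_dY (H : IsSaddleJet g β τ) :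
    HasJet (fun q => q.1 * dY (dY (dY g)) (q.1, q.1 * q.2)) (fun _ => 0)
      (fun _ => 6 * taylorCoeff g 0 3)
      (fun t => 6 * taylorCoeff g 1 3 + 24 * taylorCoeff g 0 4 * t) := by
  have hb := binomDeriv_iterate H.contDiff 0 3
  simp only [Function.iterate_zero, Function.iterate_succ, Function.comp_apply, id_eq] at hb
  refine (hasJet_mul_blowup (contDiff_dY (contDiff_dY (contDiff_dY H.contDiff)))).congr_coeff
    (fun t => rfl) (fun t => ?_) (fun t => ?_)
  · rw [hb]; simp [Nat.factorial]; ring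
  · rw [hb]; simp [Finset.Nat.antidiagonal_succ, Nat.factorial]; ring

end IsSaddleJet

theorem exists_hasJet {a b c : ℝ → ℝ} (ha : ContDiff ℝ 1 a) (hb : ContDiff ℝ 1 b)
    (hc : ContDiff ℝ 1 c) : ∃ h, HasJet h a b c :=
  ⟨fun q => a q.2 + q.1 * b q.2 + q.1 ^ 2 * c q.2, ha, hb, hc, fun _ => 0, contDiff_const,
    fun x t => by simp⟩

/-! ### Size of the function along the vertex and inflexion branches. -/

/-- If `W = Q * F + x ^ 2 * e + O(x ^ 3)`, then `F` is divisible by `x ^ 2` on the zero set of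
`W`, where `Q` does not vanish. -/
theorem HasJet.exists_eq_sq_mul {W F Q : ℝ × ℝ → ℝ} {e : ℝ → ℝ} {s : ℝ}
    (H : HasJet (fun q => W q - Q q * F q) (fun _ => 0) (fun _ => 0) e) (hQ : ContDiff ℝ 1 Q)
    (hQs : Q (0, s) ≠ 0) : ∃ K : ℝ × ℝ → ℝ, ContDiffAt ℝ 1 K (0, s) ∧
      K (0, s) = -e s / Q (0, s) ∧ ∀ᶠ q in 𝓝 ((0, s) : ℝ × ℝ), W q = 0 → F q = q.1 ^ 2 * K q := by
  obtain ⟨-, -, he, ρ, hρ, h⟩ := H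
  -- On `W = 0` the relation reads `-Q * F = x ^ 2 * (e + x * ρ)`, which is solved for `F`. No
  -- parametrization of the zero set is needed.
  refine ⟨fun q => -(e q.2 + q.1 * ρ q) / Q q, ContDiffAt.div (by fun_prop)
    hQ.contDiffAt hQs, by simp, ?_⟩
  filter_upwards [hQ.continuous.continuousAt.eventually_ne hQs]
  rintro ⟨x, t⟩ hq h0
  have := h x t
  simp only at h0 this ⊢
  rw [h0] at this
  rw [mul_div_assoc', eq_div_iff hq]
  linear_combination -this

/-- The leading coefficient of `g` along the branch of `vertexFun g = 0` tangent to `y = s * x`, up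
to a positive factor. -/
noncomputable def vertexCoeff (g : ℝ × ℝ → ℝ) (β s : ℝ) : ℝ :=
  (taylorCoeff g 3 0 + taylorCoeff g 2 1 * s + taylorCoeff g 1 2 * s ^ 2 +
      taylorCoeff g 0 3 * s ^ 3) *
    (taylorCoeff g 3 0 * (1 + 5 * s ^ 2) - taylorCoeff g 2 1 * (s - 3 * s ^ 3) -
      taylorCoeff g 1 2 * (3 * s ^ 2 - s ^ 4) - taylorCoeff g 0 3 * (s ^ 5 + 5 * s ^ 3)) -
    4 * β * s ^ 2 * (1 + s ^ 2) *
      (taylorCoeff g 4 0 + taylorCoeff g 3 1 * s + taylorCoeff g 2 2 * s ^ 2 +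
        taylorCoeff g 1 3 * s ^ 3 + taylorCoeff g 0 4 * s ^ 4)

namespace IsSaddleJet

variable {g : ℝ × ℝ → ℝ} {β τ : ℝ}

/-- The combination `J + 8 * τ ^ 2 * β ^ 2 * F` vanishes on `x = 0`. Hence on `J = 0` the function
`F` is `x` times a `C¹` function, whose value at `(0, s)` is a first-order jet coefficient that
reduces to the cubic part when `s = ±τ`. -/
theorem exists_blowup_inflexionFun (H : IsSaddleJet g β τ) (hβ : 0 < β) (hτ : 0 < τ) :
    ∃ F J : ℝ × ℝ → ℝ, ContDiff ℝ 1 F ∧ ContDiff ℝ 1 J ∧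
      (∀ x t, g (x, x * t) = x ^ 2 * F (x, t)) ∧
      (∀ x t, inflexionFun g (x, x * t) = x ^ 2 * J (x, t)) ∧
      (∀ t, J (0, t) = -8 * τ ^ 2 * β ^ 3 * (τ ^ 2 - t ^ 2)) ∧
      ∀ s, s ^ 2 = τ ^ 2 → ∃ K : ℝ × ℝ → ℝ, ContDiffAt ℝ 1 K (0, s) ∧
        K (0, s) = taylorCoeff g 3 0 + taylorCoeff g 2 1 * s + taylorCoeff g 1 2 * s ^ 2 +
          taylorCoeff g 0 3 * s ^ 3 ∧
        ∀ᶠ q in 𝓝 ((0, s) : ℝ × ℝ), J q = 0 → F q = q.1 ^ 1 * K q := by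
  obtain ⟨F, hF, jF⟩ := H.exists_blowup_self
  obtain ⟨A, hA, jA⟩ := H.exists_blowup_dX
  obtain ⟨B, hB, jB⟩ := H.exists_blowup_dY
  have jxx := H.hasJet_dX_dX
  have jxy := H.hasJet_dX_dY
  have jyy := H.hasJet_dY_dY
  have jJ := ((jxx.mul (jB.mul jB)).sub ((jxy.mul (jA.mul jB)).const_mul 2)).add
    (jyy.mul (jA.mul jA))
  obtain ⟨-, h1, h2, ρ, hρ, e⟩ := jJ.add (jF.const_mul (8 * τ ^ 2 * β ^ 2))
  refine ⟨F, _, jF.contDiff, jJ.contDiff, hF, fun x t => ?_, fun t => ?_, fun s hs => ?_⟩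
  · simp only [inflexionFun, hA, hB]
    ring
  · rw [jJ.apply_zero]
    ring
  · refine ⟨_, ContDiff.contDiffAt (ContDiff.div_const (c := 8 * τ ^ 2 * β ^ 2)
      ((h1.comp contDiff_snd).add ((contDiff_fst.mul (h2.comp contDiff_snd)).add
        ((contDiff_fst.pow 2).mul hρ)))), ?_, Eventually.of_forall ?_⟩
    · simp only [Function.comp_apply]
      rw [div_eq_iff (by positivity)]
      obtain rfl | rfl := sq_eq_sq_iff_eq_or_eq_neg.1 hs <;> ring
    · rintro ⟨x, t⟩ h0
      have := e x t
      simp only at h0 this ⊢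
      rw [h0, zero_add] at this
      have h8 : (8 * τ ^ 2 * β ^ 2) ≠ 0 := by positivity
      rw [mul_div_assoc', eq_div_iff h8, mul_comm, this]
      simp only [Function.comp_apply]
      ring

/-- A multiplier `Q` is found with `W - Q * F = O(x ^ 2)`. On `W = 0` this makes `F` divisible by `x
^ 2`, and the coefficient at `s = ±τ` can be read off from the jets. The divisibility reflects the
contact, of at least three points, of the vertex branches with `g = 0`. -/
theorem exists_blowup_vertexFun (H : IsSaddleJet g β τ) (hβ : 0 < β) (hτ : 0 < τ) :
    ∃ F W : ℝ × ℝ → ℝ, ContDiff ℝ 1 F ∧ ContDiff ℝ 1 W ∧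
      (∀ x t, g (x, x * t) = x ^ 2 * F (x, t)) ∧
      (∀ x t, vertexFun g (x, x * t) = x ^ 4 * W (x, t)) ∧
      (∀ t, F (0, t) = β * (τ ^ 2 - t ^ 2)) ∧
      (∀ t, W (0, t) = 192 * β ^ 6 * τ ^ 4 * (1 + τ ^ 2) * t * (τ ^ 2 - t ^ 2)) ∧
      ∀ s, s ^ 2 = τ ^ 2 → ∃ K : ℝ × ℝ → ℝ, ContDiffAt ℝ 1 K (0, s) ∧
        K (0, s) = vertexCoeff g β s / (4 * β * s ^ 2 * (1 + s ^ 2)) ∧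
        ∀ᶠ q in 𝓝 ((0, s) : ℝ × ℝ), W q = 0 → F q = q.1 ^ 2 * K q := by
  obtain ⟨F, hF, jF⟩ := H.exists_blowup_self
  obtain ⟨A, hA, jA⟩ := H.exists_blowup_dX
  obtain ⟨B, hB, jB⟩ := H.exists_blowup_dY
  have jxx := H.hasJet_dX_dX
  have jxy := H.hasJet_dX_dY
  have jyy := H.hasJet_dY_dY
  have jxxx := H.hasJet_mul_dX_dX_dX
  have jxxy := H.hasJet_mul_dX_dX_dY
  have jxyy := H.hasJet_mul_dX_dY_dY
  have jyyy := H.hasJet_mul_dY_dY_dY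
  have jAA := jA.mul jA
  have jBB := jB.mul jB
  have jAB := jA.mul jB
  have jW1 := (jAA.add jBB).mul (((((jB.mul jBB).mul jxxx).neg.add
    (((jA.mul jBB).mul jxxy).const_mul 3)).sub (((jAA.mul jB).mul jxyy).const_mul 3)).add
      ((jA.mul jAA).mul jyyy))
  have jW2 := (jAB.mul (((jBB.mul (jxx.mul jxx)).add ((jAA.sub jBB).mul (jxx.mul jyy))).sub
    (jAA.mul (jyy.mul jyy)))).const_mul 3
  have jW3 := ((jAB.mul (jxy.mul jxy)).mul (jAA.sub jBB)).const_mul 6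
  have jW4 := (jxy.mul (((jxx.mul (jBB.mul jBB)).sub
    (((jAA.mul jBB).mul (jxx.sub jyy)).const_mul 3)).sub (jyy.mul (jAA.mul jAA)))).const_mul 3
  have jW := jW1.add ((jW2.add jW3).add jW4)
  -- With `F₀ = β * (τ ^ 2 - t ^ 2)`, the coefficients are `Q₀ = W₀ / F₀` and `Q₁ = (W₁ - Q₀ * F₁) /
  -- F₀`, both polynomials in `t`. The `x ^ 2` coefficient of `Q` may be taken to be `0`, since it
  -- would be multiplied by `F₀ (±τ) = 0`.
  obtain ⟨Q, jQ⟩ : ∃ Q : ℝ × ℝ → ℝ, HasJet Q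
      (fun t => 192 * β ^ 5 * τ ^ 4 * (1 + τ ^ 2) * t)
      (fun t => 96 * β ^ 4 * (t ^ 3 * (τ ^ 4 * taylorCoeff g 1 2 - τ ^ 2 * taylorCoeff g 1 2 -
          2 * taylorCoeff g 3 0)
        + t ^ 2 * (-7 * τ ^ 6 * taylorCoeff g 0 3 + 6 * τ ^ 4 * taylorCoeff g 2 1 -
          13 * τ ^ 4 * taylorCoeff g 0 3)
        + t * (13 * τ ^ 4 * taylorCoeff g 3 0 - 6 * τ ^ 4 * taylorCoeff g 1 2 +
          7 * τ ^ 2 * taylorCoeff g 3 0)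
        + (2 * τ ^ 8 * taylorCoeff g 0 3 + τ ^ 6 * taylorCoeff g 2 1 -
          τ ^ 4 * taylorCoeff g 2 1))) (fun _ => 0) :=
    exists_hasJet (by fun_prop) (by fun_prop) (by fun_prop)
  have hQc := jQ.contDiff
  have hQ0 := jQ.apply_zero
  have jE := jW.sub (jQ.mul jF)
  have jE' := jE.congr_coeff (a' := fun _ => 0) (b' := fun _ => 0) (fun t => by ring)
    (fun t => by ring) (fun t => rfl)
  refine ⟨F, _, jF.contDiff, jW.contDiff, hF, fun x t => ?_, jF.apply_zero, fun t => ?_,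
    fun s hs => ?_⟩
  · rw [vertexFun_eq]
    simp only [hA, hB]
    ring
  · rw [jW.apply_zero]
    ring
  · have hs0 : s ≠ 0 := by
      rintro rfl
      have : 0 < τ ^ 2 := by positivity
      simp at hs; exact this.ne hs
    obtain ⟨K, hK, hKs, hKe⟩ := jE'.exists_eq_sq_mul (s := s) hQc (by rw [hQ0]; positivity)
    refine ⟨K, hK, hKs.trans ?_, hKe⟩
    rw [hQ0, div_eq_div_iff (by positivity) (by positivity), vertexCoeff]
    obtain rfl | rfl := sq_eq_sq_iff_eq_or_eq_neg.1 hs <;> ring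

end IsSaddleJet

/-! ### Counting the points of a level on smooth half-branches. -/

/-- The derivative is `x ^ n * ((n + 1) * K x + x * K' x)`, and the bracket tends to `(n + 1) * K 0
> 0`. -/
theorem eventually_pos_deriv_pow_mul {K : ℝ → ℝ} (hK : ContDiffAt ℝ 1 K 0) (h0 : 0 < K 0) (n : ℕ) :
    ∀ᶠ x in 𝓝 (0 : ℝ), 0 < x → 0 < K x ∧
      ∃ d, 0 < d ∧ HasDerivAt (fun x => x ^ (n + 1) * K x) d x := by
  have hd : ∀ᶠ x in 𝓝 (0 : ℝ), ContDiffAt ℝ 1 K x := hK.eventually (by simp)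
  have hc : ContinuousAt (fun x => (n + 1) * K x + x * fderiv ℝ K x 1) 0 := by
    have h1 : ContinuousAt (fderiv ℝ K) 0 := (hK.fderiv_right (m := 0) (by simp)).continuousAt
    have h2 := hK.continuousAt
    fun_prop
  have hpos : 0 < (fun x => (n + 1) * K x + x * fderiv ℝ K x 1) 0 := by
    simp only [zero_mul, add_zero]; positivity
  filter_upwards [hd, hc.eventually (lt_mem_nhds hpos), hK.continuousAt.eventually (lt_mem_nhds h0)]
    with x h1 h2 h3 hx
  refine ⟨h3, x ^ n * ((n + 1) * K x + x * fderiv ℝ K x 1), by positivity, ?_⟩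
  have := (hasDerivAt_pow (n + 1) x).mul (h1.differentiableAt (by simp)).hasDerivAt
  refine this.congr_deriv ?_
  rw [← fderiv_apply_one_eq_deriv]
  push_cast
  ring

/-- For small `k > 0` the equation `x ^ (n + 1) * K x = k` has exactly one small positive solution,
if `K 0 > 0`. -/
theorem eventually_existsUnique_pow_mul {K G : ℝ → ℝ} (hK : ContDiffAt ℝ 1 K 0) (h0 : 0 < K 0)
    (n : ℕ) (hG : ∀ᶠ x in 𝓝 (0 : ℝ), G x = x ^ (n + 1) * K x) :
    ∀ᶠ δ in 𝓝[>] (0 : ℝ), ∀ s > 0, ∀ᶠ k in 𝓝[>] (0 : ℝ),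
      ∃ x ∈ Ioo 0 s, G x = k ∧ ∀ x' ∈ Ioo 0 δ, G x' = k → x' = x := by
  obtain ⟨ε, hε, H⟩ := Metric.eventually_nhds_iff.1
    ((eventually_pos_deriv_pow_mul hK h0 n).and (hG.and (hK.eventually (by simp))))
  have Habs : ∀ x, 0 ≤ x → x < ε → dist x 0 < ε := fun x h1 h2 => by
    rwa [Real.dist_eq, sub_zero, abs_of_nonneg h1]
  have hcont : ContinuousOn (fun x => x ^ (n + 1) * K x) (Ico 0 ε) := fun x hx =>
    ((continuousAt_id.pow _).mul (H (Habs x hx.1 hx.2)).2.2.continuousAt).continuousWithinAt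
  have hmono : StrictMonoOn (fun x => x ^ (n + 1) * K x) (Ico 0 ε) := by
    refine strictMonoOn_of_deriv_pos (convex_Ico 0 ε) hcont fun x hx => ?_
    rw [interior_Ico] at hx
    obtain ⟨-, d, hd, hd'⟩ := (H (Habs x hx.1.le hx.2)).1 hx.1
    rwa [hd'.deriv]
  filter_upwards [Ioo_mem_nhdsGT hε] with δ hδ s hs
  -- Uniqueness comes from monotonicity on an interval fixed in advance. Existence uses the
  -- intermediate value theorem on the shorter `[0, s']`, so the solution can be forced into any
  -- prescribed neighbourhood.
  set s' := min (s / 2) (ε / 2)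
  have hs' : 0 < s' := by positivity
  have hs'1 : s' < s := (min_le_left _ _).trans_lt (by linarith)
  have hs'2 : s' < ε := (min_le_right _ _).trans_lt (by linarith)
  have hp : 0 < s' ^ (n + 1) * K s' := by
    have := ((H (Habs s' hs'.le hs'2)).1 hs').1
    positivity
  filter_upwards [Ioo_mem_nhdsGT hp] with k hk
  obtain ⟨x, hx, hxk⟩ := intermediate_value_Ioo hs'.le
    (hcont.mono (Icc_subset_Ico_right hs'2)) (show k ∈ Ioo _ _ by simpa using hk)
  have e : ∀ y, 0 ≤ y → y < ε → G y = y ^ (n + 1) * K y := fun y h1 h2 => (H (Habs y h1 h2)).2.1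
  refine ⟨x, ⟨hx.1, hx.2.trans hs'1⟩, ?_, fun x' hx' hk' => ?_⟩
  · rw [e x hx.1.le (hx.2.trans hs'2)]; exact hxk
  · rw [e x' hx'.1.le (hx'.2.trans hδ.2)] at hk'
    exact hmono.injOn ⟨hx'.1.le, hx'.2.trans hδ.2⟩ ⟨hx.1.le, hx.2.trans hs'2⟩ (hk'.trans hxk.symm)

theorem eventually_neg_pow_mul {K G : ℝ → ℝ} (hK : ContinuousAt K 0) (h0 : K 0 < 0)
    (n : ℕ) (hG : ∀ᶠ x in 𝓝 (0 : ℝ), G x = x ^ (n + 1) * K x) :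
    ∀ᶠ δ in 𝓝[>] (0 : ℝ), ∀ x ∈ Ioo 0 δ, G x < 0 := by
  obtain ⟨ε, hε, H⟩ := Metric.eventually_nhds_iff.1 ((hK.eventually (gt_mem_nhds h0)).and hG)
  filter_upwards [Ioo_mem_nhdsGT hε] with δ hδ x hx
  obtain ⟨h1, h2⟩ := H (show dist x 0 < ε by
    rw [Real.dist_eq, sub_zero, abs_of_pos hx.1]; exact hx.2.trans hδ.2)
  rw [h2]
  exact mul_neg_of_pos_of_neg (pow_pos hx.1 _) h1

/-- The zero set of `W` near a simple zero of `W (0, ·)` is a `C¹` graph. -/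
theorem exists_graph_of_simple_zero {W : ℝ × ℝ → ℝ} (hW : ContDiff ℝ 1 W) {z w : ℝ}
    (h0 : W (0, z) = 0) (hw : w ≠ 0) (hd : HasDerivAt (fun t => W (0, t)) w z) :
    ∃ T : ℝ → ℝ, ContDiffAt ℝ 1 T 0 ∧ T 0 = z ∧
      ∀ᶠ q in 𝓝 ((0, z) : ℝ × ℝ), W q = 0 ↔ T q.1 = q.2 := by
  have hinv : (fderiv ℝ W (0, z) ∘L .inr ℝ ℝ ℝ).IsInvertible := by
    refine ⟨ContinuousLinearEquiv.unitsEquivAut ℝ (Units.mk0 w hw), ?_⟩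
    ext
    have h1 : HasFDerivAt W (fderiv ℝ W (0, z)) (0, z) :=
      (hW.differentiable (by simp) _).hasFDerivAt
    have h2 := (h1.comp z (hasFDerivAt_prodMk_right (0 : ℝ) z)).hasDerivAt
    have h3 := hd.unique h2
    simpa using h3
  have cd : ContDiffAt ℝ 1 W (0, z) := hW.contDiffAt
  refine ⟨cd.implicitFunction one_ne_zero hinv, cd.contDiffAt_implicitFunction one_ne_zero hinv,
    cd.implicitFunction_apply_self one_ne_zero hinv, ?_⟩
  simpa [h0] using cd.eventually_apply_eq_iff_implicitFunction one_ne_zero hinv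

/-- In the chart `(x, t) ↦ (x, x * t)`, the functions `g` and `P` are `x ^ 2 * F` and `x ^ m * W`,
the points with `g > 0` lie in the cone `|t| ≤ M`, the zeros of `W (0, ·)` are the elements of `Z`
and are simple, and along the branch of `W = 0` through `(0, z)` the function `F` is `c z` times a
power of `x` of parity `σ`, to leading order. -/
structure IsBranchedChart (g P F W : ℝ × ℝ → ℝ) (m : ℕ) (M σ : ℝ) (Z : Finset ℝ) (c : ℝ → ℝ) :
    Prop where
  contDiff_F : ContDiff ℝ 1 F
  contDiff_W : ContDiff ℝ 1 W
  g_eq : ∀ x t, g (x, x * t) = x ^ 2 * F (x, t)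
  P_eq : ∀ x t, P (x, x * t) = x ^ m * W (x, t)
  cone : ∀ᶠ p in 𝓝 ((0, 0) : ℝ × ℝ), 0 < g p → |p.2| ≤ M * |p.1|
  mem_of_zero : ∀ t, W (0, t) = 0 → t ∈ Z
  zero : ∀ z ∈ Z, W (0, z) = 0
  simple : ∀ z ∈ Z, ∃ w ≠ 0, HasDerivAt (fun t => W (0, t)) w z
  ne_zero : ∀ z ∈ Z, c z ≠ 0
  branch : ∀ z ∈ Z, ∃ (j : ℕ) (K : ℝ × ℝ → ℝ), (-1) ^ j = σ ∧ ContDiffAt ℝ 1 K (0, z) ∧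
    K (0, z) = c z ∧ ∀ᶠ q in 𝓝 ((0, z) : ℝ × ℝ), W q = 0 → F q = q.1 ^ j * K q

namespace IsBranchedChart

variable {g P F W : ℝ × ℝ → ℝ} {m : ℕ} {M σ : ℝ} {Z : Finset ℝ} {c : ℝ → ℝ}

/-- Reflection in the origin keeps the slope `t` and changes `x` to `-x`, so the leading coefficient
on each branch is multiplied by `(-1) ^ j = σ`. This carries the half-plane `x < 0` to `x > 0`. -/
theorem comp_neg (H : IsBranchedChart g P F W m M σ Z c) :
    IsBranchedChart (fun p => g (-p)) (fun p => P (-p)) (fun q => F (-q.1, q.2))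
      (fun q => (-1) ^ m * W (-q.1, q.2)) m M σ Z (fun z => σ * c z) where
  contDiff_F := H.contDiff_F.comp (by fun_prop)
  contDiff_W := contDiff_const.mul (H.contDiff_W.comp (by fun_prop))
  g_eq x t := by
    have := H.g_eq (-x) t
    simpa using this
  P_eq x t := by
    have := H.P_eq (-x) t
    rw [Prod.neg_mk, ← neg_mul, this, neg_pow]
    ring
  cone := by
    have h : Tendsto (fun p : ℝ × ℝ => -p) (𝓝 (0, 0)) (𝓝 (0, 0)) := by
      have : Continuous fun p : ℝ × ℝ => -p := continuous_neg
      simpa using this.tendsto (0, 0)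
    filter_upwards [h.eventually H.cone] with p hp
    simpa using hp
  mem_of_zero t ht := H.mem_of_zero t (by simpa using ht)
  zero z hz := by simp [H.zero z hz]
  simple z hz := by
    obtain ⟨w, hw, hd⟩ := H.simple z hz
    refine ⟨(-1) ^ m * w, mul_ne_zero (by simp) hw, ?_⟩
    simpa using hd.const_mul ((-1) ^ m)
  ne_zero z hz := by
    obtain ⟨j, -, hj, -⟩ := H.branch z hz
    exact mul_ne_zero (by rw [← hj]; simp) (H.ne_zero z hz)
  branch z hz := by
    obtain ⟨j, K, hj, hK, hz', he⟩ := H.branch z hz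
    have h : Tendsto (fun q : ℝ × ℝ => (-q.1, q.2)) (𝓝 (0, z)) (𝓝 (0, z)) := by
      have : Continuous fun q : ℝ × ℝ => (-q.1, q.2) := by fun_prop
      simpa using this.tendsto (0, z)
    refine ⟨j, fun q => σ * K (-q.1, q.2), hj, contDiffAt_const.mul ?_, by simp [hz'], ?_⟩
    · exact ContDiffAt.comp (g := K) (f := fun q : ℝ × ℝ => (-q.1, q.2)) (0, z)
        (by simpa using hK) (by fun_prop)
    · filter_upwards [h.eventually he] with q hq h0
      rw [hq (by simpa using h0), ← hj, neg_pow]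
      ring

/-- Compactness of the slope interval: near a zero slope the zero set is the corresponding graph,
near any other slope `W` does not vanish, and finitely many such neighbourhoods suffice. -/
theorem eventually_exists_graph (H : IsBranchedChart g P F W m M σ Z c) {T : ℝ → ℝ → ℝ}
    (hT : ∀ z ∈ Z, ∀ᶠ q in 𝓝 ((0, z) : ℝ × ℝ), W q = 0 ↔ T z q.1 = q.2) :
    ∀ᶠ x in 𝓝 (0 : ℝ), ∀ t ∈ Icc (-M) M, W (x, t) = 0 → ∃ z ∈ Z, T z x = t := by
  refine isCompact_Icc.eventually_forall_of_forall_eventually fun t _ => ?_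
  by_cases ht : t ∈ Z
  · filter_upwards [hT t ht] with q hq h0
    exact ⟨t, ht, hq.1 h0⟩
  · have : W (0, t) ≠ 0 := fun h => ht (H.mem_of_zero t h)
    filter_upwards [H.contDiff_W.continuous.continuousAt.eventually_ne this] with q hq h0
    exact absurd h0 hq

/-- For small `k > 0`, the points of `g = k`, `P = 0` in the half-plane `x > 0` correspond to the
branches of `P = 0` on which `g` is positive there. -/
theorem encard_eq (H : IsBranchedChart g P F W m M σ Z c) :
    ∃ N ∈ 𝓝 ((0, 0) : ℝ × ℝ), ∀ U ∈ 𝓝 ((0, 0) : ℝ × ℝ), U ⊆ N → ∀ᶠ k in 𝓝[>] (0 : ℝ),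
      {p ∈ U | 0 < p.1 ∧ g p = k ∧ P p = 0}.encard = (Z.filter (0 < c ·)).card := by
  have hex : ∀ z ∈ Z, ∃ T : ℝ → ℝ, ContDiffAt ℝ 1 T 0 ∧ T 0 = z ∧
      ∀ᶠ q in 𝓝 ((0, z) : ℝ × ℝ), W q = 0 ↔ T q.1 = q.2 := fun z hz => by
    obtain ⟨w, hw, hd⟩ := H.simple z hz
    exact exists_graph_of_simple_zero H.contDiff_W (H.zero z hz) hw hd
  choose! T hTc hT0 hT using hex
  have hlim : ∀ z ∈ Z, Tendsto (fun x => (x, T z x)) (𝓝 0) (𝓝 ((0, z) : ℝ × ℝ)) := fun z hz => by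
    have h := (hTc z hz).continuousAt.tendsto
    rw [hT0 z hz] at h
    exact tendsto_id.prodMk_nhds h
  have hlim' : ∀ z ∈ Z, Tendsto (fun x => (x, x * T z x)) (𝓝 0) (𝓝 ((0, 0) : ℝ × ℝ)) :=
    fun z hz => by
      have h := (hTc z hz).continuousAt.tendsto
      have := tendsto_id.prodMk_nhds (tendsto_id.mul h)
      simpa using this
  have E1 := H.eventually_exists_graph hT
  have E2 : ∀ᶠ x in 𝓝 (0 : ℝ), ∀ z ∈ Z, W (x, T z x) = 0 := by
    rw [Finset.eventually_all]
    intro z hz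
    filter_upwards [(hlim z hz).eventually (hT z hz)] with x hx
    exact hx.2 rfl
  have E3 : ∀ᶠ x in 𝓝 (0 : ℝ), ∀ z ∈ Z, ∀ z' ∈ Z, T z x = T z' x → z = z' := by
    rw [Finset.eventually_all]
    intro z hz
    rw [Finset.eventually_all]
    intro z' hz'
    rcases eq_or_ne z z' with h | h
    · exact Eventually.of_forall fun _ _ => h
    · have hne : (fun x => T z x - T z' x) 0 ≠ 0 := by
        simpa only [hT0 z hz, hT0 z' hz'] using sub_ne_zero.2 h
      have hcont : ContinuousAt (fun x => T z x - T z' x) 0 :=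
        (hTc z hz).continuousAt.sub (hTc z' hz').continuousAt
      filter_upwards [hcont.eventually_ne hne] with x hx he
      exact absurd (sub_eq_zero.2 he) hx
  have E4 : ∀ᶠ δ in 𝓝[>] (0 : ℝ), ∀ z ∈ Z,
      (0 < c z → ∀ s > 0, ∀ᶠ k in 𝓝[>] (0 : ℝ), ∃ x ∈ Ioo 0 s, g (x, x * T z x) = k ∧
        ∀ x' ∈ Ioo 0 δ, g (x', x' * T z x') = k → x' = x) ∧
      (c z < 0 → ∀ x ∈ Ioo 0 δ, g (x, x * T z x) < 0) := by
    rw [Finset.eventually_all]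
    intro z hz
    obtain ⟨j, K, -, hK, hKz, he⟩ := H.branch z hz
    have hK' : ContDiffAt ℝ 1 (fun x => K (x, T z x)) 0 :=
      ContDiffAt.comp (g := K) (f := fun x => (x, T z x)) 0 (by rwa [hT0 z hz])
        (contDiffAt_id.prodMk (hTc z hz))
    -- The exponent is `j + 2`: `j` from `F` and `2` from `g = x ^ 2 * F`. It is positive even on a
    -- branch transverse to `g = 0`, where `j = 0`.
    have hG : ∀ᶠ x in 𝓝 (0 : ℝ), g (x, x * T z x) = x ^ (j + 1 + 1) * K (x, T z x) := by
      filter_upwards [(hlim z hz).eventually he, E2] with x hx hW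
      rw [H.g_eq, hx (hW z hz)]
      ring
    rcases lt_or_gt_of_ne (H.ne_zero z hz) with h | h
    · filter_upwards [eventually_neg_pow_mul hK'.continuousAt (by simp only [hT0 z hz, hKz, h]) (j + 1) hG]
        with δ hδ
      exact ⟨fun h' => absurd h h'.not_gt, fun _ => hδ⟩
    · filter_upwards [eventually_existsUnique_pow_mul hK' (by simp only [hT0 z hz, hKz, h]) (j + 1) hG]
        with δ hδ
      exact ⟨fun _ => hδ, fun h' => absurd h h'.not_gt⟩
  obtain ⟨ε, hε, HE⟩ := Metric.eventually_nhds_iff.1 (E1.and (E2.and E3))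
  obtain ⟨δ, hE4, hδ0, hδε⟩ := (E4.and (Ioo_mem_nhdsGT hε)).exists
  have HE' : ∀ x ∈ Ioo 0 δ, _ := fun x hx => HE (show dist x 0 < ε by
    rw [Real.dist_eq, sub_zero, abs_of_pos hx.1]; exact hx.2.trans hδε)
  -- This neighbourhood is fixed before `U`; only the bound on `k` will depend on `U`.
  refine ⟨{p | p.1 < δ} ∩ {p | 0 < g p → |p.2| ≤ M * |p.1|}, inter_mem
    ((isOpen_lt continuous_fst continuous_const).mem_nhds hδ0) H.cone, fun U hU hUN => ?_⟩
  have hs : ∀ z ∈ Z, ∃ s > 0, ∀ x ∈ Ioo 0 s, (x, x * T z x) ∈ U := fun z hz => by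
    obtain ⟨s, hs, h⟩ := Metric.eventually_nhds_iff.1 ((hlim' z hz).eventually hU)
    exact ⟨s, hs, fun x hx => h (by rw [Real.dist_eq, sub_zero, abs_of_pos hx.1]; exact hx.2)⟩
  choose! s hs0 hsU using hs
  have E5 : ∀ᶠ k in 𝓝[>] (0 : ℝ), ∀ z ∈ Z, 0 < c z → ∃ x ∈ Ioo 0 (s z),
      g (x, x * T z x) = k ∧ ∀ x' ∈ Ioo 0 δ, g (x', x' * T z x') = k → x' = x := by
    rw [Finset.eventually_all]
    intro z hz
    by_cases h : 0 < c z
    · filter_upwards [(hE4 z hz).1 h (s z) (hs0 z hz)] with k hk _ using hk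
    · exact Eventually.of_forall fun _ h' => absurd h' h
  filter_upwards [E5, self_mem_nhdsWithin] with k hk hk0
  choose! X hXs hXk hXu using hk
  have hXU : ∀ z ∈ Z, 0 < c z → (X z, X z * T z (X z)) ∈ U := fun z hz h =>
    hsU z hz _ (hXs z hz h)
  have hXδ : ∀ z ∈ Z, 0 < c z → X z ∈ Ioo 0 δ := fun z hz h =>
    ⟨(hXs z hz h).1, (hUN (hXU z hz h)).1⟩
  -- A point of a positive level with `x > 0` has its slope in the compact interval, hence lies on
  -- one of the graphs. A graph with `c z < 0` is excluded because `g < 0` there, and each of the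
  -- others contributes exactly one point.
  have hset : {p ∈ U | 0 < p.1 ∧ g p = k ∧ P p = 0} =
      (fun z => (X z, X z * T z (X z))) '' (Z.filter (0 < c ·) : Finset ℝ) := by
    ext ⟨x, y⟩
    constructor
    · rintro ⟨hU', hx, hgk, hP⟩
      simp only at hx
      have hxδ : x ∈ Ioo 0 δ := ⟨hx, (hUN hU').1⟩
      have hcone := (hUN hU').2 (by rw [hgk]; exact hk0)
      simp only [abs_of_pos hx] at hcone
      obtain ⟨t, rfl⟩ : ∃ t, y = x * t := ⟨y / x, by field_simp⟩
      rw [H.P_eq] at hP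
      have hW : W (x, t) = 0 := (mul_eq_zero.1 hP).resolve_left (pow_pos hx _).ne'
      rw [abs_mul, abs_of_pos hx, mul_comm] at hcone
      have ht : t ∈ Icc (-M) M := abs_le.1 (le_of_mul_le_mul_right hcone hx)
      obtain ⟨z, hz, rfl⟩ := (HE' x hxδ).1 t ht hW
      have hc : 0 < c z := by
        by_contra hc
        have := (hE4 z hz).2 (lt_of_le_of_ne (not_lt.1 hc) (H.ne_zero z hz)) x hxδ
        rw [hgk] at this
        exact this.not_gt hk0
      refine ⟨z, by simp [hz, hc], ?_⟩
      rw [hXu z hz hc x hxδ hgk]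
    · rintro ⟨z, hz, he⟩
      simp only [Finset.coe_filter, mem_ofPred_eq] at hz
      rw [← he]
      refine ⟨hXU z hz.1 hz.2, (hXδ z hz.1 hz.2).1, hXk z hz.1 hz.2, ?_⟩
      rw [H.P_eq, (HE' _ (hXδ z hz.1 hz.2)).2.1 z hz.1, mul_zero]
  rw [hset, InjOn.encard_image, Set.encard_coe_eq_coe_finsetCard]
  intro z hz z' hz' he
  simp only [Finset.coe_filter, mem_ofPred_eq] at hz hz'
  simp only [Prod.mk.injEq] at he
  obtain ⟨h1, h2⟩ := he
  rw [← h1] at h2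
  exact (HE' _ (hXδ z hz.1 hz.2)).2.2 z hz.1 z' hz'.1
    (mul_left_cancel₀ (hXδ z hz.1 hz.2).1.ne' h2)

/-- The version of `IsBranchedChart.encard_eq` for the half-plane `x < 0`. -/
theorem encard_eq_neg (H : IsBranchedChart g P F W m M σ Z c) :
    ∃ N ∈ 𝓝 ((0, 0) : ℝ × ℝ), ∀ U ∈ 𝓝 ((0, 0) : ℝ × ℝ), U ⊆ N → ∀ᶠ k in 𝓝[>] (0 : ℝ),
      {p ∈ U | p.1 < 0 ∧ g p = k ∧ P p = 0}.encard = (Z.filter (0 < σ * c ·)).card := by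
  have h : Tendsto (fun p : ℝ × ℝ => -p) (𝓝 (0, 0)) (𝓝 (0, 0)) := by
    have : Continuous fun p : ℝ × ℝ => -p := continuous_neg
    simpa using this.tendsto (0, 0)
  obtain ⟨N, hN, HN⟩ := H.comp_neg.encard_eq
  refine ⟨(fun p => -p) ⁻¹' N, h hN, fun U hU hUN => ?_⟩
  filter_upwards [HN ((fun p => -p) ⁻¹' U) (h hU) (fun p hp => by simpa using hUN hp)] with k hk
  rw [← hk, ← (neg_injective.injOn (s := _)).encard_image]
  congr 1
  ext p
  simp
  tauto

end IsBranchedChart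

/-! ### Exchanging the axes, to turn negative levels into positive ones. -/

/-- The function `(x, y) ↦ -g (y, x)`. -/
def swapNeg (g : ℝ × ℝ → ℝ) : ℝ × ℝ → ℝ := fun p => -g p.swap

theorem contDiff_swapNeg {g : ℝ × ℝ → ℝ} (hg : ContDiff ℝ ∞ g) : ContDiff ℝ ∞ (swapNeg g) :=
  (hg.comp (contDiff_snd.prodMk contDiff_fst)).neg

theorem fderiv_swapNeg (g : ℝ × ℝ → ℝ) (p v : ℝ × ℝ) :
    fderiv ℝ (swapNeg g) p v = -fderiv ℝ g p.swap v.swap := by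
  have h1 : swapNeg g = -(g ∘ ContinuousLinearEquiv.prodComm ℝ ℝ ℝ) := rfl
  rw [h1, fderiv_neg, (ContinuousLinearEquiv.prodComm ℝ ℝ ℝ).comp_right_fderiv]
  rfl

theorem dX_swapNeg (g : ℝ × ℝ → ℝ) : dX (swapNeg g) = swapNeg (dY g) := by
  funext p; exact fderiv_swapNeg g p (1, 0)

theorem dY_swapNeg (g : ℝ × ℝ → ℝ) : dY (swapNeg g) = swapNeg (dX g) := by
  funext p; exact fderiv_swapNeg g p (0, 1)

theorem taylorCoeff_swapNeg {g : ℝ × ℝ → ℝ} (hg : ContDiff ℝ ∞ g) (i j : ℕ) :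
    taylorCoeff (swapNeg g) i j = -taylorCoeff g j i := by
  have hX : ∀ (n : ℕ) (h : ℝ × ℝ → ℝ), dX^[n] (swapNeg h) = swapNeg (dY^[n] h) := fun n h =>
    (Function.Semiconj.iterate_right (f := swapNeg) (ga := dY) (gb := dX)
      (fun h => (dX_swapNeg h).symm) n h).symm
  have hY : ∀ (n : ℕ) (h : ℝ × ℝ → ℝ), dY^[n] (swapNeg h) = swapNeg (dX^[n] h) := fun n h =>
    (Function.Semiconj.iterate_right (f := swapNeg) (ga := dX) (gb := dY)
      (fun h => (dY_swapNeg h).symm) n h).symm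
  rw [taylorCoeff, taylorCoeff, hY, hX, iterate_dY_iterate_dX hg, mul_comm (j.factorial : ℝ),
    ← neg_div]
  rfl

theorem vertexFun_swapNeg {g : ℝ × ℝ → ℝ} (hg : ContDiff ℝ ∞ g) (p : ℝ × ℝ) :
    vertexFun (swapNeg g) p = -vertexFun g p.swap := by
  simp only [vertexFun, dX_swapNeg, dY_swapNeg, dY_dX hg, dY_dX (contDiff_dX hg),
    dY_dX (contDiff_dY hg)]
  simp only [swapNeg]
  ring

theorem inflexionFun_swapNeg {g : ℝ × ℝ → ℝ} (hg : ContDiff ℝ ∞ g) (p : ℝ × ℝ) :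
    inflexionFun (swapNeg g) p = -inflexionFun g p.swap := by
  simp only [inflexionFun, dX_swapNeg, dY_swapNeg, dY_dX hg]
  simp only [swapNeg]
  ring

/-! ### Branched charts for the vertex and inflexion functions. -/

namespace IsSaddleJet

variable {g : ℝ × ℝ → ℝ} {β τ : ℝ}

/-- The quadratic part `β * (τ ^ 2 * x ^ 2 - y ^ 2)` becomes `β * τ ^ 2 * (τ⁻¹ ^ 2 * x ^ 2 - y ^
2)`. The parameters `(a ^ 2, a⁻¹)` thus go to `(1, a)`. -/
theorem swapNeg (H : IsSaddleJet g β τ) (hτ : 0 < τ) :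
    IsSaddleJet (swapNeg g) (β * τ ^ 2) τ⁻¹ where
  contDiff := contDiff_swapNeg H.contDiff
  c00 := by rw [taylorCoeff_swapNeg H.contDiff, H.c00, neg_zero]
  c10 := by rw [taylorCoeff_swapNeg H.contDiff, H.c01, neg_zero]
  c01 := by rw [taylorCoeff_swapNeg H.contDiff, H.c10, neg_zero]
  c20 := by rw [taylorCoeff_swapNeg H.contDiff, H.c02]; field_simp
  c11 := by rw [taylorCoeff_swapNeg H.contDiff, H.c11, neg_zero]
  c02 := by rw [taylorCoeff_swapNeg H.contDiff, H.c20]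

/-- The blow-up of the swapped function is positive for `|x / y| ≤ 1 / (2 * τ)`, uniformly by
compactness, so `g` is not positive near the `y`-axis, which the chart `(x, x * t)` misses. Any
constant above `τ` would do in place of `2 * τ`. -/
theorem eventually_cone (H : IsSaddleJet g β τ) (hβ : 0 < β) (hτ : 0 < τ) :
    ∀ᶠ p in 𝓝 ((0, 0) : ℝ × ℝ), 0 < g p → |p.2| ≤ 2 * τ * |p.1| := by
  obtain ⟨F, hF, jF⟩ := (H.swapNeg hτ).exists_blowup_self
  have h1 : ∀ᶠ y in 𝓝 (0 : ℝ), ∀ t ∈ Icc (-(2 * τ)⁻¹) (2 * τ)⁻¹, 0 < F (y, t) := by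
    refine isCompact_Icc.eventually_forall_of_forall_eventually fun t ht => ?_
    refine jF.contDiff.continuous.continuousAt.eventually (lt_mem_nhds ?_)
    rw [jF.apply_zero]
    have h2 : t ^ 2 ≤ ((2 * τ)⁻¹) ^ 2 := sq_le_sq' ht.1 ht.2
    have h3 : ((2 * τ)⁻¹) ^ 2 < τ⁻¹ ^ 2 := by
      have : 0 < τ⁻¹ ^ 2 := by positivity
      rw [mul_inv, mul_pow]
      linarith
    have : 0 < τ⁻¹ ^ 2 - t ^ 2 := by linarith
    positivity
  filter_upwards [(continuous_snd.tendsto ((0, 0) : ℝ × ℝ)).eventually h1]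
  rintro ⟨x, y⟩ h hg
  simp only at h ⊢
  by_contra! hlt
  have hy : y ≠ 0 := by
    rintro rfl
    rw [abs_zero] at hlt
    exact hlt.not_ge (by positivity)
  have hy' : 0 < |y| := abs_pos.2 hy
  have ht : |x / y| ≤ (2 * τ)⁻¹ := by
    rw [abs_div, div_le_iff₀ hy', ← div_eq_inv_mul, le_div_iff₀ (by positivity)]
    linarith
  have h2 := h (x / y) (abs_le.1 ht)
  have h3 := hF y (x / y)
  rw [mul_div_cancel₀ _ hy] at h3
  simp only [_root_.swapNeg, Prod.swap_prod_mk] at h3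
  have : 0 < y ^ 2 * F (y, x / y) := by positivity
  linarith

/-- The exponents `j` are `0` on the branch of slope `0` and `2` on the asymptotic ones, all even,
whence the parity sign `1`. -/
theorem exists_vertexChart (H : IsSaddleJet g β τ) (hβ : 0 < β) (hτ : 0 < τ)
    (h1 : vertexCoeff g β τ ≠ 0) (h2 : vertexCoeff g β (-τ) ≠ 0) :
    ∃ F W, IsBranchedChart g (vertexFun g) F W 4 (2 * τ) 1 {0, τ, -τ}
      (fun z => if z = 0 then β * τ ^ 2 else
        vertexCoeff g β z / (4 * β * z ^ 2 * (1 + z ^ 2))) := by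
  obtain ⟨F, W, hF, hW, hgF, hgW, hF0, hW0, hb⟩ := H.exists_blowup_vertexFun hβ hτ
  have hC : 192 * β ^ 6 * τ ^ 4 * (1 + τ ^ 2) ≠ 0 := by positivity
  have hmem : ∀ z ∈ ({0, τ, -τ} : Finset ℝ), z = 0 ∨ z ≠ 0 ∧ z ^ 2 = τ ^ 2 ∧ vertexCoeff g β z ≠ 0 := by
    intro z hz
    simp only [Finset.mem_insert, Finset.mem_singleton] at hz
    rcases hz with rfl | rfl | rfl
    · exact Or.inl rfl
    · exact Or.inr ⟨hτ.ne', rfl, h1⟩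
    · exact Or.inr ⟨by simpa using hτ.ne', by ring, h2⟩
  refine ⟨F, W, hF, hW, hgF, hgW, H.eventually_cone hβ hτ, fun t ht => ?_, fun z hz => ?_,
    fun z hz => ?_, fun z hz => ?_, fun z hz => ?_⟩
  · rw [hW0, mul_assoc] at ht
    have := (mul_eq_zero.1 ht).resolve_left hC
    rw [mul_eq_zero, sub_eq_zero, eq_comm (a := τ ^ 2), sq_eq_sq_iff_eq_or_eq_neg] at this
    simpa using this
  · rw [hW0]
    rcases hmem z hz with rfl | ⟨-, h, -⟩
    · ring
    · rw [h]; ring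
  · refine ⟨192 * β ^ 6 * τ ^ 4 * (1 + τ ^ 2) * (τ ^ 2 - 3 * z ^ 2), mul_ne_zero hC ?_, ?_⟩
    · have : 0 < τ ^ 2 := by positivity
      rcases hmem z hz with rfl | ⟨-, h, -⟩
      · nlinarith
      · rw [h]; nlinarith
    · simp only [hW0]
      have h3 := (hasDerivAt_id' z).fun_mul ((hasDerivAt_pow 2 z).const_sub (τ ^ 2))
      have := h3.const_mul (192 * β ^ 6 * τ ^ 4 * (1 + τ ^ 2))
      simp only [← mul_assoc] at this ⊢
      refine this.congr_deriv ?_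
      push_cast
      ring
  · rcases hmem z hz with rfl | ⟨h, -, hv⟩
    · simp only [if_true]; positivity
    · rw [if_neg h]
      exact div_ne_zero hv (by positivity)
  · rcases hmem z hz with rfl | ⟨h, hs, -⟩
    · exact ⟨0, F, by norm_num, hF.contDiffAt, by simp [hF0],
        Eventually.of_forall fun q _ => by simp⟩
    · obtain ⟨K, hK, hKz, he⟩ := hb z hs
      exact ⟨2, K, by norm_num, hK, by rw [hKz, if_neg h], he⟩

/-- Here `j = 1` on both branches, so the parity sign is `-1` and the half-planes `x > 0` and `x <
0` receive complementary branches. -/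
theorem exists_inflexionChart (H : IsSaddleJet g β τ) (hβ : 0 < β) (hτ : 0 < τ) {d : ℝ → ℝ}
    (hd : ∀ s, d s = taylorCoeff g 3 0 + taylorCoeff g 2 1 * s + taylorCoeff g 1 2 * s ^ 2 +
          taylorCoeff g 0 3 * s ^ 3) (h1 : d τ ≠ 0) (h2 : d (-τ) ≠ 0) :
    ∃ F W, IsBranchedChart g (inflexionFun g) F W 2 (2 * τ) (-1) {τ, -τ} d := by
  obtain ⟨F, W, hF, hW, hgF, hgW, hW0, hb⟩ := H.exists_blowup_inflexionFun hβ hτ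
  have hC : -8 * τ ^ 2 * β ^ 3 ≠ 0 :=
    mul_ne_zero (mul_ne_zero (by norm_num) (by positivity)) (by positivity)
  have hmem : ∀ z ∈ ({τ, -τ} : Finset ℝ), z ≠ 0 ∧ z ^ 2 = τ ^ 2 ∧ d z ≠ 0 := by
    intro z hz
    simp only [Finset.mem_insert, Finset.mem_singleton] at hz
    rcases hz with rfl | rfl
    · exact ⟨hτ.ne', rfl, h1⟩
    · exact ⟨by simpa using hτ.ne', by ring, h2⟩
  refine ⟨F, W, hF, hW, hgF, hgW, H.eventually_cone hβ hτ, fun t ht => ?_, fun z hz => ?_,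
    fun z hz => ?_, fun z hz => (hmem z hz).2.2, fun z hz => ?_⟩
  · rw [hW0, mul_eq_zero, sub_eq_zero, eq_comm (a := τ ^ 2),
      sq_eq_sq_iff_eq_or_eq_neg] at ht
    simpa using ht.resolve_left hC
  · rw [hW0, (hmem z hz).2.1, sub_self, mul_zero]
  · refine ⟨-8 * τ ^ 2 * β ^ 3 * (-(2 * z)), mul_ne_zero hC (by simpa using (hmem z hz).1), ?_⟩
    simp only [hW0]
    have := ((hasDerivAt_pow 2 z).const_sub (τ ^ 2)).const_mul (-8 * τ ^ 2 * β ^ 3)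
    simpa using this
  · obtain ⟨K, hK, hKz, he⟩ := hb z (hmem z hz).2.1
    exact ⟨1, K, by norm_num, hK, by rw [hKz, hd], he⟩

end IsSaddleJet

/-! ### Topology of the level curves of a saddle. -/

theorem ConvexOn.le_of_hasDerivAt_zero {f : ℝ → ℝ} {s : Set ℝ} {x y : ℝ} (hf : ConvexOn ℝ s f)
    (hx : x ∈ s) (hy : y ∈ s) (hd : HasDerivAt f 0 x) : f x ≤ f y := by
  rcases lt_trichotomy x y with h | rfl | h
  · have := hf.le_slope_of_hasDerivAt hx hy h hd
    rw [slope_def_field, le_div_iff₀ (sub_pos.2 h)] at this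
    linarith
  · exact le_rfl
  · have := hf.slope_le_of_hasDerivAt hy hx h hd
    rw [slope_def_field, div_le_iff₀ (sub_pos.2 h)] at this
    linarith

/-- Convexity in `x` with `h (0, y) ≤ 0` makes `h` strictly increasing to the right once it has
reached `k > 0`, so a horizontal segment meets the level at most once. The half-level is then the
graph of a continuous function of `y` over `{y | k < h (r, y)}`, an interval by concavity. -/
theorem isPreconnected_level_pos {h : ℝ × ℝ → ℝ} {r k : ℝ} (hr : 0 < r) (hk : 0 < k)
    (hc : Continuous h) (h0 : ∀ y ∈ Ioo (-r) r, h (0, y) ≤ 0)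
    (hconv : ∀ y ∈ Ioo (-r) r, ConvexOn ℝ (Icc 0 r) (fun x => h (x, y)))
    (hconc : ConcaveOn ℝ (Ioo (-r) r) (fun y => h (r, y))) (hrk : k < h (r, 0)) :
    IsPreconnected {p | p ∈ Ioo (-r) r ×ˢ Ioo (-r) r ∧ h p = k ∧ 0 < p.1} ∧
      {p | p ∈ Ioo (-r) r ×ˢ Ioo (-r) r ∧ h p = k ∧ 0 < p.1}.Nonempty := by
  have hmono : ∀ y ∈ Ioo (-r) r, ∀ x x', 0 < x → x < x' → x' ≤ r → k ≤ h (x, y) →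
      h (x, y) < h (x', y) := fun y hy x x' hx hxx' hx' hle => by
    refine (hconv y hy).lt_right_of_left_lt (x := 0) ⟨le_rfl, hr.le⟩ ⟨(hx.trans hxx').le, hx'⟩ ?_
      ((h0 y hy).trans_lt (hk.trans_le hle))
    rw [openSegment_eq_Ioo (hx.trans hxx')]
    exact ⟨hx, hxx'⟩
  have hex : ∀ y ∈ Ioo (-r) r, k < h (r, y) → ∃ x ∈ Ioo 0 r, h (x, y) = k := fun y hy hyk => by
    have hcx : Continuous fun x => h (x, y) := hc.comp (by fun_prop)
    exact intermediate_value_Ioo hr.le hcx.continuousOn ⟨(h0 y hy).trans_lt hk, hyk⟩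
  set S := {y ∈ Ioo (-r) r | k < h (r, y)} with hS
  have hex' : ∀ y ∈ S, ∃ x ∈ Ioo 0 r, h (x, y) = k := fun y hy => hex y hy.1 hy.2
  choose! X hX hXk using hex'
  have huniq : ∀ y ∈ Ioo (-r) r, ∀ x ∈ Ioo 0 r, h (x, y) = k → y ∈ S ∧ x = X y := by
    intro y hy x hx hxk
    have hyS : y ∈ S := ⟨hy, hxk ▸ hmono y hy x r hx.1 hx.2 le_rfl hxk.ge⟩
    refine ⟨hyS, ?_⟩
    rcases lt_trichotomy x (X y) with hlt | he | hlt
    · have := hmono y hy x (X y) hx.1 hlt (hX y hyS).2.le hxk.ge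
      rw [hXk y hyS, hxk] at this
      exact absurd this (lt_irrefl _)
    · exact he
    · have := hmono y hy (X y) x (hX y hyS).1 hlt hx.2.le (hXk y hyS).ge
      rw [hXk y hyS, hxk] at this
      exact absurd this (lt_irrefl _)
  have hset : {p | p ∈ Ioo (-r) r ×ˢ Ioo (-r) r ∧ h p = k ∧ 0 < p.1} = (fun y => (X y, y)) '' S := by
    ext ⟨x, y⟩
    constructor
    · rintro ⟨⟨hx, hy⟩, hxk, hx0⟩
      obtain ⟨hyS, rfl⟩ := huniq y hy x ⟨hx0, hx.2⟩ hxk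
      exact ⟨y, hyS, rfl⟩
    · rintro ⟨y, hy, he⟩
      rw [← he]
      have := hX y hy
      exact ⟨⟨⟨by linarith [this.1], this.2⟩, hy.1⟩, hXk y hy, this.1⟩
  have hScont : ContinuousOn X S := by
    intro y hy
    have hXy := hX y hy
    rw [ContinuousWithinAt, Metric.tendsto_nhds]
    intro ε hε
    set δ := min (ε / 2) (min (X y / 2) ((r - X y) / 2)) with hδ
    have hδ0 : 0 < δ := by
      have h1 := hXy.1
      have h2 : 0 < r - X y := sub_pos.2 hXy.2
      positivity
    have hδ1 : δ ≤ ε / 2 := min_le_left _ _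
    have hδ2 : δ ≤ X y / 2 := (min_le_right _ _).trans (min_le_left _ _)
    have hδ3 : δ ≤ (r - X y) / 2 := (min_le_right _ _).trans (min_le_right _ _)
    -- Continuity of the graph: at the abscissae `X y ± δ` the values of `h` lie on either side of
    -- `k`, and they still do so for nearby `y'`, which traps `X y'` between them.
    have hup : k < h (X y + δ, y) := by
      have := hmono y hy.1 (X y) (X y + δ) hXy.1 (by linarith) (by linarith [hXy.2]) (hXk y hy).ge
      rwa [hXk y hy] at this
    have hlo : h (X y - δ, y) < k := by
      by_contra! hle
      have := hmono y hy.1 (X y - δ) (X y) (by linarith [hXy.1]) (by linarith) hXy.2.le hle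
      rw [hXk y hy] at this
      exact hle.not_gt this
    have hcu : Continuous fun y' => h (X y + δ, y') := hc.comp (by fun_prop)
    have hcl : Continuous fun y' => h (X y - δ, y') := hc.comp (by fun_prop)
    filter_upwards [self_mem_nhdsWithin,
      mem_nhdsWithin_of_mem_nhds (hcu.continuousAt.eventually (lt_mem_nhds hup)),
      mem_nhdsWithin_of_mem_nhds (hcl.continuousAt.eventually (gt_mem_nhds hlo))] with y' hy' h1 h2
    have hXy' := hX y' hy'
    have hl : X y - δ < X y' := by
      by_contra! hle
      rcases hle.eq_or_lt with he | hlt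
      · rw [← he, hXk y' hy'] at h2
        exact lt_irrefl _ h2
      · have := hmono y' hy'.1 (X y') (X y - δ) hXy'.1 hlt (by linarith [hXy.2]) (hXk y' hy').ge
        rw [hXk y' hy'] at this
        exact this.not_gt h2
    have hu : X y' < X y + δ := by
      by_contra! hle
      rcases hle.eq_or_lt with he | hlt
      · rw [he, hXk y' hy'] at h1
        exact lt_irrefl _ h1
      · have := hmono y' hy'.1 (X y + δ) (X y') (by linarith [hXy.1]) hlt hXy'.2.le h1.le
        rw [hXk y' hy'] at this
        exact this.not_gt h1
    rw [Real.dist_eq, abs_lt]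
    constructor <;> linarith
  rw [hset]
  refine ⟨((hconc.convex_gt k).isPreconnected).image _ (hScont.prodMk continuousOn_id),
    Set.Nonempty.image _ ⟨0, ⟨by linarith, hr⟩, hrk⟩⟩

theorem hasDerivAt_slice_fst {h : ℝ × ℝ → ℝ} (hh : ContDiff ℝ ∞ h) (x y : ℝ) :
    HasDerivAt (fun x => h (x, y)) (dX h (x, y)) x :=
  ((hh.differentiable (by simp) (x, y)).hasFDerivAt.comp x
    (hasFDerivAt_prodMk_left (𝕜 := ℝ) x y)).hasDerivAt

theorem hasDerivAt_slice_snd {h : ℝ × ℝ → ℝ} (hh : ContDiff ℝ ∞ h) (x y : ℝ) :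
    HasDerivAt (fun y => h (x, y)) (dY h (x, y)) y :=
  ((hh.differentiable (by simp) (x, y)).hasFDerivAt.comp y
    (hasFDerivAt_prodMk_right (𝕜 := ℝ) x y)).hasDerivAt

theorem strictConvexOn_slice_fst {h : ℝ × ℝ → ℝ} (hh : ContDiff ℝ ∞ h) {s : Set ℝ} (hs : Convex ℝ s)
    {y : ℝ} (h2 : ∀ x ∈ s, 0 < dX (dX h) (x, y)) : StrictConvexOn ℝ s (fun x => h (x, y)) := by
  refine strictConvexOn_of_deriv2_pos' hs (hh.continuous.comp (by fun_prop)).continuousOn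
    fun x hx => ?_
  have h1 : deriv (fun x => h (x, y)) = fun x => dX h (x, y) := by
    funext x; exact (hasDerivAt_slice_fst hh x y).deriv
  simp only [Function.iterate_succ, Function.iterate_zero, Function.comp_apply, id_eq, h1]
  rw [(hasDerivAt_slice_fst (contDiff_dX hh) x y).deriv]
  exact h2 x hx

theorem strictConcaveOn_slice_snd {h : ℝ × ℝ → ℝ} (hh : ContDiff ℝ ∞ h) {s : Set ℝ}
    (hs : Convex ℝ s) {x : ℝ} (h2 : ∀ y ∈ s, dY (dY h) (x, y) < 0) :
    StrictConcaveOn ℝ s (fun y => h (x, y)) := by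
  refine strictConcaveOn_of_deriv2_neg' hs (hh.continuous.comp (by fun_prop)).continuousOn
    fun y hy => ?_
  have h1 : deriv (fun y => h (x, y)) = fun y => dY h (x, y) := by
    funext y; exact (hasDerivAt_slice_snd hh x y).deriv
  simp only [Function.iterate_succ, Function.iterate_zero, Function.comp_apply, id_eq, h1]
  rw [(hasDerivAt_slice_snd (contDiff_dY hh) x y).deriv]
  exact h2 y hy

/-- The topology of the level curves `g = k > 0` of a function with a saddle point at the origin:
they are nonsingular, with one branch in each of the half-planes `x > 0` and `x < 0`. -/
theorem IsSaddleJet.eventually_level {g : ℝ × ℝ → ℝ} {β τ : ℝ} (H : IsSaddleJet g β τ) (hβ : 0 < β)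
    (hτ : 0 < τ) : ∀ᶠ r in 𝓝[>] (0 : ℝ), ∀ᶠ k in 𝓝[>] (0 : ℝ),
      (∀ p ∈ Ioo (-r) r ×ˢ Ioo (-r) r, g p = k → fderiv ℝ g p ≠ 0 ∧ p.1 ≠ 0) ∧
      (IsPreconnected {p | p ∈ Ioo (-r) r ×ˢ Ioo (-r) r ∧ g p = k ∧ 0 < p.1} ∧
        {p | p ∈ Ioo (-r) r ×ˢ Ioo (-r) r ∧ g p = k ∧ 0 < p.1}.Nonempty) ∧
      (IsPreconnected {p | p ∈ Ioo (-r) r ×ˢ Ioo (-r) r ∧ g p = k ∧ p.1 < 0} ∧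
        {p | p ∈ Ioo (-r) r ×ˢ Ioo (-r) r ∧ g p = k ∧ p.1 < 0}.Nonempty) := by
  have hg := H.contDiff
  have hX : dX g (0, 0) = 0 := by simpa [taylorCoeff] using H.c10
  have hY : dY g (0, 0) = 0 := by simpa [taylorCoeff] using H.c01
  have hXX : 0 < dX (dX g) (0, 0) := by
    have : dX (dX g) (0, 0) / 2 = β * τ ^ 2 := by simpa [taylorCoeff] using H.c20
    have : 0 < dX (dX g) (0, 0) / 2 := by rw [this]; positivity
    linarith
  have hYY : dY (dY g) (0, 0) < 0 := by
    have : dY (dY g) (0, 0) / 2 = -β := by simpa [taylorCoeff] using H.c02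
    linarith
  have h00 : g (0, 0) = 0 := by simpa [taylorCoeff] using H.c00
  obtain ⟨ε, hε, hE⟩ := Metric.eventually_nhds_iff.1
    (((contDiff_dX (contDiff_dX hg)).continuous.continuousAt.eventually (lt_mem_nhds hXX)).and
      ((contDiff_dY (contDiff_dY hg)).continuous.continuousAt.eventually (gt_mem_nhds hYY)))
  filter_upwards [Ioo_mem_nhdsGT hε] with r ⟨hr, hrε⟩
  have hE' : ∀ x y, x ∈ Icc (-r) r → y ∈ Icc (-r) r →
      0 < dX (dX g) (x, y) ∧ dY (dY g) (x, y) < 0 := fun x y hx hy => by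
    refine hE ?_
    rw [Prod.dist_eq, max_lt_iff, Real.dist_eq, Real.dist_eq, sub_zero, sub_zero]
    exact ⟨(abs_le.2 hx).trans_lt hrε, (abs_le.2 hy).trans_lt hrε⟩
  have hconv : ∀ y ∈ Icc (-r) r, StrictConvexOn ℝ (Icc (-r) r) (fun x => g (x, y)) :=
    fun y hy => strictConvexOn_slice_fst hg (convex_Icc _ _) fun x hx => (hE' x y hx hy).1
  have hconc : ∀ x ∈ Icc (-r) r, StrictConcaveOn ℝ (Icc (-r) r) (fun y => g (x, y)) :=
    fun x hx => strictConcaveOn_slice_snd hg (convex_Icc _ _) fun y hy => (hE' x y hx hy).2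
  have m0 : (0 : ℝ) ∈ Icc (-r) r := ⟨by linarith, hr.le⟩
  have mr : r ∈ Icc (-r) r := ⟨by linarith, le_rfl⟩
  have mr' : -r ∈ Icc (-r) r := ⟨le_rfl, by linarith⟩
  -- The origin is a critical point, hence the maximum of the concave slice along the `y`-axis.
  -- Positive levels therefore do not meet this axis.
  have hle : ∀ y ∈ Icc (-r) r, g (0, y) ≤ 0 := fun y hy => by
    have h1 := (hconc 0 m0).concaveOn.neg
    have h2 : HasDerivAt (-fun y => g (0, y)) 0 0 := by
      simpa [hY] using (hasDerivAt_slice_snd hg 0 0).neg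
    have := h1.le_of_hasDerivAt_zero m0 hy h2
    simp only [Pi.neg_apply, h00] at this
    linarith
  have hpos : ∀ x ∈ Icc (-r) r, x ≠ 0 → 0 < g (x, 0) := fun x hx hx0 => by
    have h2 : HasDerivAt (fun x => g (x, 0)) 0 0 := (hasDerivAt_slice_fst hg 0 0).congr_deriv hX
    have half : (0 : ℝ) < 1 / 2 := by norm_num
    have h3 := (hconv 0 m0).2 m0 hx hx0.symm half half (by norm_num)
    have h4 := (hconv 0 m0).convexOn.le_of_hasDerivAt_zero m0
      ((hconv 0 m0).1 m0 hx half.le half.le (by norm_num)) h2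
    simp only [h00, smul_eq_mul] at h3 h4
    linarith
  filter_upwards [Ioo_mem_nhdsGT (lt_min (hpos r mr hr.ne') (hpos (-r) mr' (by linarith [hr] : -r < 0).ne))]
    with k ⟨hk, hk'⟩
  obtain ⟨hk1, hk2⟩ := lt_min_iff.1 hk'
  have hsub : Ioo (-r) r ⊆ Icc (-r) r := Ioo_subset_Icc_self
  refine ⟨?_, ?_, ?_⟩
  · rintro ⟨x, y⟩ ⟨hx, hy⟩ he
    constructor
    -- At a critical point convexity in `x` would give `g (x, y) ≤ g (0, y) ≤ 0`, against `k > 0`.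
    · intro hd
      have h2 : HasDerivAt (fun x => g (x, y)) 0 x := by
        have := hasDerivAt_slice_fst hg x y
        rwa [dX, hd] at this
      have := (hconv y (hsub hy)).convexOn.le_of_hasDerivAt_zero (hsub hx) m0 h2
      linarith [hle y (hsub hy)]
    · rintro h
      simp only at h
      subst h
      linarith [hle y (hsub hy)]
  · exact isPreconnected_level_pos hr hk hg.continuous (fun y hy => hle y (hsub hy))
      (fun y hy => (hconv y (hsub hy)).convexOn.subset (Icc_subset_Icc_left (by linarith))
        (convex_Icc _ _)) ((hconc r mr).concaveOn.subset hsub (convex_Ioo _ _)) hk1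
  · have hneg : ∀ y ∈ Ioo (-r) r, ConvexOn ℝ (Icc 0 r) (fun x => g (-x, y)) := fun y hy =>
      ((hconv y (hsub hy)).convexOn.comp_linearMap (-LinearMap.id)).subset
        (fun x hx => ⟨by simpa using hx.2, by simpa using (neg_nonpos.2 hx.1).trans hr.le⟩)
        (convex_Icc _ _)
    obtain ⟨hp, hn⟩ := isPreconnected_level_pos (h := fun p : ℝ × ℝ => g (-p.1, p.2)) hr hk
      (hg.continuous.comp (by fun_prop)) (fun y hy => by simpa using hle y (hsub hy)) hneg
      ((hconc (-r) mr').concaveOn.subset hsub (convex_Ioo _ _)) hk2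
    have himg : {p | p ∈ Ioo (-r) r ×ˢ Ioo (-r) r ∧ g p = k ∧ p.1 < 0} =
        (fun p : ℝ × ℝ => (-p.1, p.2)) ''
          {p | p ∈ Ioo (-r) r ×ˢ Ioo (-r) r ∧ g (-p.1, p.2) = k ∧ 0 < p.1} := by
      ext ⟨x, y⟩
      constructor
      · rintro ⟨⟨hx, hy⟩, he, h0⟩
        exact ⟨(-x, y), ⟨⟨⟨by linarith [hx.2], by linarith [hx.1]⟩, hy⟩, by simpa using he,
          by simpa using h0⟩, by simp⟩
      · rintro ⟨⟨x', y'⟩, ⟨⟨hx, hy⟩, he, h0⟩, h⟩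
        obtain ⟨rfl, rfl⟩ := Prod.mk.inj h
        exact ⟨⟨⟨by linarith [hx.2], by linarith [hx.1]⟩, hy⟩, he, by simpa using h0⟩
    rw [himg]
    exact ⟨hp.image _ (by fun_prop), hn.image _⟩

/-! ### Curvature of level curves. -/

theorem hasDerivAt_comp_curve {h : ℝ × ℝ → ℝ} (hh : ContDiff ℝ ∞ h) {γ : ℝ → ℝ × ℝ} {t x' y' : ℝ}
    (h1 : HasDerivAt (fun u => (γ u).1) x' t) (h2 : HasDerivAt (fun u => (γ u).2) y' t) :
    HasDerivAt (fun u => h (γ u)) (x' * dX h (γ t) + y' * dY h (γ t)) t := by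
  have := (hh.differentiable (by simp) (γ t)).hasFDerivAt.comp_hasDerivAt t (h1.prodMk h2)
  rwa [fderiv_eq_dX_dY] at this

theorem fderiv_ne_zero_iff {g : ℝ × ℝ → ℝ} {p : ℝ × ℝ} :
    fderiv ℝ g p ≠ 0 ↔ dX g p ≠ 0 ∨ dY g p ≠ 0 := by
  rw [← not_and_or, not_iff_not]
  constructor
  · intro h; simp [dX, dY, h]
  · rintro ⟨h1, h2⟩
    ext
    · simpa [dX] using h1
    · simpa [dY] using h2

theorem exists_graph_of_dY_ne_zero {g : ℝ × ℝ → ℝ} (hg : ContDiff ℝ ∞ g) {p : ℝ × ℝ}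
    (hp : dY g p ≠ 0) : ∃ ψ : ℝ → ℝ, ContDiffAt ℝ ∞ ψ p.1 ∧ ψ p.1 = p.2 ∧
      ∀ᶠ x in 𝓝 p.1, g (x, ψ x) = g p := by
  have hinv : (fderiv ℝ g p ∘L .inr ℝ ℝ ℝ).IsInvertible := by
    refine ⟨ContinuousLinearEquiv.unitsEquivAut ℝ (Units.mk0 _ hp), ?_⟩
    ext
    simp [dY]
  have cd : ContDiffAt ℝ ∞ g p := hg.contDiffAt
  exact ⟨cd.implicitFunction (by simp) hinv, cd.contDiffAt_implicitFunction (by simp) hinv,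
    cd.implicitFunction_apply_self (by simp) hinv,
    cd.eventually_apply_implicitFunction (by simp) hinv⟩

/-- Needed because vertices and inflexions are defined by the existence of a parametrization. The
curve is a graph over one of the axes; when `dX g p ≠ 0` the swapped function is used. -/
theorem exists_isLevelParam {g : ℝ × ℝ → ℝ} (hg : ContDiff ℝ ∞ g) {p : ℝ × ℝ}
    (hp : fderiv ℝ g p ≠ 0) : ∃ γ, IsLevelParam g p γ := by
  have hlim : ∀ c : ℝ, Tendsto (fun t : ℝ => c + t) (𝓝 0) (𝓝 c) := fun c => by
    have : Continuous fun t : ℝ => c + t := by fun_prop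
    simpa using this.tendsto 0
  have hcomp : ∀ (ψ : ℝ → ℝ) (c : ℝ), ContDiffAt ℝ ∞ ψ c → ContDiffAt ℝ ∞ (fun t => ψ (c + t)) 0 :=
    fun ψ c h => ContDiffAt.comp (g := ψ) (f := fun t => c + t) 0 (by simpa using h) (by fun_prop)
  have hd1 : ∀ c : ℝ, HasDerivAt (fun t : ℝ => c + t) 1 0 := fun c =>
    (hasDerivAt_id' (0 : ℝ)).const_add c
  rcases fderiv_ne_zero_iff.1 hp with h | h
  · have h' : dY (swapNeg g) p.swap ≠ 0 := by
      rw [dY_swapNeg]; simpa [swapNeg] using h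
    obtain ⟨ψ, hψ, hψ0, he⟩ := exists_graph_of_dY_ne_zero (contDiff_swapNeg hg) h'
    rw [Prod.fst_swap] at hψ hψ0 he
    have hd := ((hcomp ψ p.2 hψ).differentiableAt (by simp)).hasDerivAt.prodMk (hd1 p.2)
    refine ⟨fun t => (ψ (p.2 + t), p.2 + t), (hcomp ψ p.2 hψ).prodMk (by fun_prop), ?_, ?_, ?_⟩
    · simp [hψ0]
    · rw [hd.deriv]; simp
    · filter_upwards [(hlim p.2).eventually he] with t ht
      simpa [swapNeg] using ht
  · obtain ⟨ψ, hψ, hψ0, he⟩ := exists_graph_of_dY_ne_zero hg h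
    have hd := (hd1 p.1).prodMk ((hcomp ψ p.1 hψ).differentiableAt (by simp)).hasDerivAt
    refine ⟨fun t => (p.1 + t, ψ (p.1 + t)), ContDiffAt.prodMk (by fun_prop) (hcomp ψ p.1 hψ), ?_, ?_,
      (hlim p.1).eventually he⟩
    · simp [hψ0]
    · rw [hd.deriv]; simp

/-- Since `(l ^ 2) ^ (3 / 2) = |l| ^ 3`, only the sign of the speed factor `l` survives: curvature
depends on the parametrization through orientation alone. -/
theorem cube_mul_div_rpow {l G : ℝ} (hl : l ≠ 0) (hG : 0 < G) (I : ℝ) :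
    l ^ 3 * I / (l ^ 2 * G) ^ (3 / 2 : ℝ) = SignType.sign l * (I / G ^ (3 / 2 : ℝ)) := by
  have h1 : (l ^ 2 : ℝ) ^ (3 / 2 : ℝ) = |l| ^ 3 := by
    rw [← sq_abs, ← Real.rpow_natCast, ← Real.rpow_mul (abs_nonneg l), ← Real.rpow_natCast]
    norm_num
  have hG' : 0 < G ^ (3 / 2 : ℝ) := by positivity
  rw [Real.mul_rpow (sq_nonneg l) hG.le, h1]
  rcases lt_or_gt_of_ne hl with h | h
  · rw [abs_of_neg h, sign_neg h]
    simp only [SignType.coe_neg_one]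
    field_simp
  · rw [abs_of_pos h, sign_pos h]
    simp only [SignType.coe_one]
    field_simp

section Curvature

variable {g : ℝ × ℝ → ℝ} {p : ℝ × ℝ} {γ : ℝ → ℝ × ℝ}

/-- The curvature of a parametrized level curve, in terms of the derivatives of the function. -/
theorem SurfaceSections.IsLevelParam.eventually_planeCurvature (hγ : IsLevelParam g p γ)
    (hg : ContDiff ℝ ∞ g) (hp : fderiv ℝ g p ≠ 0) : ∃ l : ℝ, l ≠ 0 ∧
      HasDerivAt (fun u => (γ u).1) (-(l * dY g p)) 0 ∧
      HasDerivAt (fun u => (γ u).2) (l * dX g p) 0 ∧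
      ∀ᶠ t in 𝓝 (0 : ℝ), planeCurvature γ t = SignType.sign l *
        (inflexionFun g (γ t) / (dX g (γ t) ^ 2 + dY g (γ t) ^ 2) ^ (3 / 2 : ℝ)) := by
  obtain ⟨hs, h0, hne, hlev⟩ := hγ
  set x : ℝ → ℝ := fun u => (γ u).1
  set y : ℝ → ℝ := fun u => (γ u).2
  have hx : ContDiffAt ℝ ∞ x 0 := contDiffAt_fst.comp 0 hs
  have hy : ContDiffAt ℝ ∞ y 0 := contDiffAt_snd.comp 0 hs
  have hx' : ContDiffAt ℝ ∞ (deriv x) 0 := (hx.fderiv_right (m := ∞) le_rfl).clm_apply contDiffAt_const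
  have hy' : ContDiffAt ℝ ∞ (deriv y) 0 := (hy.fderiv_right (m := ∞) le_rfl).clm_apply contDiffAt_const
  have hdiff : ∀ {u : ℝ → ℝ}, ContDiffAt ℝ ∞ u 0 → ∀ᶠ t in 𝓝 (0 : ℝ), HasDerivAt u (deriv u t) t :=
    fun {u} hu => by
      have h1 : ContDiffAt ℝ 1 u 0 := hu.of_le (by exact_mod_cast le_top)
      filter_upwards [h1.eventually (by simp)] with t ht
      exact (ht.differentiableAt (by simp)).hasDerivAt
  have ex := hdiff hx
  have ey := hdiff hy
  have ex' := hdiff hx'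
  have ey' := hdiff hy'
  have hG0 : 0 < dX g (γ 0) ^ 2 + dY g (γ 0) ^ 2 := by
    rw [h0]
    rcases fderiv_ne_zero_iff.1 hp with h | h <;> positivity
  have hγc : ContinuousAt γ 0 := hs.continuousAt
  have cX : ContinuousAt (fun t => dX g (γ t)) 0 :=
    ((contDiff_dX hg).continuous.continuousAt).comp hγc
  have cY : ContinuousAt (fun t => dY g (γ t)) 0 :=
    ((contDiff_dY hg).continuous.continuousAt).comp hγc
  have eG : ∀ᶠ t in 𝓝 (0 : ℝ), 0 < dX g (γ t) ^ 2 + dY g (γ t) ^ 2 :=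
    ((cX.pow 2).add (cY.pow 2)).eventually (lt_mem_nhds hG0)
  have e1 : ∀ᶠ t in 𝓝 (0 : ℝ), deriv x t * dX g (γ t) + deriv y t * dY g (γ t) = 0 := by
    filter_upwards [hlev.eventually_nhds, ex, ey] with t ht h1 h2
    have h3 := hasDerivAt_comp_curve hg h1 h2
    have h4 : HasDerivAt (fun u => g (γ u)) 0 t :=
      (hasDerivAt_const t (g p)).congr_of_eventuallyEq ht
    exact h3.unique h4
  -- The relation `g ∘ γ = const` differentiated twice; it expresses `γ''` paired with the gradient
  -- through the Hessian on `γ'`, which is what the curvature formula needs.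
  have e2 : ∀ᶠ t in 𝓝 (0 : ℝ), deriv (deriv x) t * dX g (γ t) + deriv (deriv y) t * dY g (γ t)
      + (deriv x t ^ 2 * dX (dX g) (γ t) + 2 * deriv x t * deriv y t * dX (dY g) (γ t) +
        deriv y t ^ 2 * dY (dY g) (γ t)) = 0 := by
    filter_upwards [e1.eventually_nhds, ex, ey, ex', ey'] with t ht h1 h2 h1' h2'
    have h3 := (h1'.mul (hasDerivAt_comp_curve (contDiff_dX hg) h1 h2)).add
      (h2'.mul (hasDerivAt_comp_curve (contDiff_dY hg) h1 h2))
    have h4 := (hasDerivAt_const t (0 : ℝ)).congr_of_eventuallyEq ht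
    have h5 := h3.unique h4
    rw [dY_dX hg] at h5
    linear_combination h5
  -- The velocity is orthogonal to the gradient, so `γ' = l * (-g_y, g_x)`, and this is the factor.
  set l : ℝ → ℝ := fun t => (dX g (γ t) * deriv y t - dY g (γ t) * deriv x t) /
    (dX g (γ t) ^ 2 + dY g (γ t) ^ 2) with hl
  have el : ∀ᶠ t in 𝓝 (0 : ℝ), deriv x t = -(l t * dY g (γ t)) ∧ deriv y t = l t * dX g (γ t) := by
    filter_upwards [e1, eG] with t h1 h2
    rw [hl]
    constructor
    · field_simp
      linear_combination dX g (γ t) * h1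
    · field_simp
      linear_combination dY g (γ t) * h1
  have hl0 : l 0 ≠ 0 := by
    intro h
    have h1 := el.self_of_nhds
    rw [h, zero_mul, zero_mul, neg_zero] at h1
    apply hne
    have h2 := ex.self_of_nhds.prodMk ey.self_of_nhds
    rw [h1.1, h1.2] at h2
    exact h2.deriv
  have hlc : ContinuousAt l 0 := by
    have h1 := hx'.continuousAt
    have h2 := hy'.continuousAt
    exact ((cX.mul h2).sub (cY.mul h1)).div ((cX.pow 2).add (cY.pow 2)) hG0.ne'
  -- The sign is locally constant, so it remains a constant factor when the curvature is
  -- differentiated.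
  have hsign : ∀ᶠ t in 𝓝 (0 : ℝ), l t ≠ 0 ∧ SignType.sign (l t) = SignType.sign (l 0) := by
    rcases lt_or_gt_of_ne hl0 with h | h
    · filter_upwards [hlc.eventually (gt_mem_nhds h)] with t ht
      exact ⟨ht.ne, by rw [sign_neg ht, sign_neg h]⟩
    · filter_upwards [hlc.eventually (lt_mem_nhds h)] with t ht
      exact ⟨ht.ne', by rw [sign_pos ht, sign_pos h]⟩
  refine ⟨l 0, hl0, ?_, ?_, ?_⟩
  · have := ex.self_of_nhds
    rwa [el.self_of_nhds.1, h0] at this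
  · have := ey.self_of_nhds
    rwa [el.self_of_nhds.2, h0] at this
  · filter_upwards [e2, eG, el, hsign] with t h2 hG ⟨h3, h4⟩ ⟨h5, h6⟩
    rw [← h6, ← cube_mul_div_rpow h5 hG]
    simp only [planeCurvature]
    congr 1
    · change deriv x t * deriv (deriv y) t - deriv y t * deriv (deriv x) t = _
      rw [h3, h4] at h2 ⊢
      rw [inflexionFun]
      linear_combination (-(l t)) * h2
    · change (deriv x t ^ 2 + deriv y t ^ 2) ^ (3 / 2 : ℝ) = _
      rw [h3, h4]
      congr 1
      ring

theorem SurfaceSections.IsLevelParam.planeCurvature_eq_zero_iff (hγ : IsLevelParam g p γ)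
    (hg : ContDiff ℝ ∞ g) (hp : fderiv ℝ g p ≠ 0) :
    planeCurvature γ 0 = 0 ↔ inflexionFun g p = 0 := by
  obtain ⟨l, hl, -, -, he⟩ := hγ.eventually_planeCurvature hg hp
  have hG0 : 0 < dX g p ^ 2 + dY g p ^ 2 := by
    rcases fderiv_ne_zero_iff.1 hp with h | h <;> positivity
  have hG' := (Real.rpow_pos_of_pos hG0 (3 / 2)).ne'
  have hs : (SignType.sign l : ℝ) ≠ 0 := by
    rcases lt_or_gt_of_ne hl with h | h
    · rw [sign_neg h]; simp
    · rw [sign_pos h]; simp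
  rw [he.self_of_nhds, hγ.2.1, mul_eq_zero, div_eq_zero_iff]
  simp [hs, hG']

/-- The derivative of `inflexionFun g / |∇g| ^ 3` along `l * (-g_y, g_x)` is `vertexFun g` up to
nonzero factors. This is where the vertex function comes from. -/
theorem SurfaceSections.IsLevelParam.deriv_planeCurvature_eq_zero_iff (hγ : IsLevelParam g p γ)
    (hg : ContDiff ℝ ∞ g) (hp : fderiv ℝ g p ≠ 0) :
    deriv (planeCurvature γ) 0 = 0 ↔ vertexFun g p = 0 := by
  obtain ⟨l, hl, hx, hy, he⟩ := hγ.eventually_planeCurvature hg hp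
  have hG0 : 0 < dX g p ^ 2 + dY g p ^ 2 := by
    rcases fderiv_ne_zero_iff.1 hp with h | h <;> positivity
  have hG' := (Real.rpow_pos_of_pos hG0 (3 / 2)).ne'
  have hG1 := (Real.rpow_pos_of_pos hG0 (3 / 2 - 1)).ne'
  have hs : (SignType.sign l : ℝ) ≠ 0 := by
    rcases lt_or_gt_of_ne hl with h | h
    · rw [sign_neg h]; simp
    · rw [sign_pos h]; simp
  have hX := contDiff_dX hg
  have hY := contDiff_dY hg
  have D : ∀ {h : ℝ × ℝ → ℝ}, ContDiff ℝ ∞ h →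
      HasDerivAt (fun u => h (γ u)) (-(l * dY g p) * dX h p + l * dX g p * dY h p) 0 := fun hh => by
    have := hasDerivAt_comp_curve hh hx hy
    rwa [hγ.2.1] at this
  have hI := (((D (contDiff_dX hX)).fun_mul ((D hY).fun_pow 2)).fun_sub
    ((((D (contDiff_dX hY)).const_mul 2).fun_mul (D hX)).fun_mul (D hY))).fun_add
    ((D (contDiff_dY hY)).fun_mul ((D hX).fun_pow 2))
  have hG := (((D hX).fun_pow 2).fun_add ((D hY).fun_pow 2)).rpow_const (p := 3 / 2)
    (Or.inl (by rw [hγ.2.1]; exact hG0.ne'))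
  have hK := ((hI.fun_div hG (by rw [hγ.2.1]; exact hG')).const_mul (SignType.sign l : ℝ)
    ).congr_of_eventuallyEq he
  rw [hK.deriv, hγ.2.1, mul_eq_zero, or_iff_right hs, div_eq_zero_iff,
    or_iff_left (pow_ne_zero 2 hG')]
  -- Splitting off one power of `|∇g| ^ 2` leaves a common half-power in both terms of the quotient
  -- rule; the rest is a polynomial identity.
  have hsplit : (dX g p ^ 2 + dY g p ^ 2) ^ (3 / 2 : ℝ) =
      (dX g p ^ 2 + dY g p ^ 2) ^ (3 / 2 - 1 : ℝ) * (dX g p ^ 2 + dY g p ^ 2) := by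
    rw [← Real.rpow_add_one hG0.ne']; norm_num
  rw [hsplit]
  have key : ∀ a b : ℝ, b = a * (l * (dX g p ^ 2 + dY g p ^ 2) ^ (3 / 2 - 1 : ℝ)) → (b = 0 ↔ a = 0) := by
    rintro a b rfl
    simp [hl, hG1]
  refine key _ _ ?_
  simp only [vertexFun, dY_dX hg, dY_dX hX, dY_dX hY]
  push_cast
  ring

theorem isVertex_iff (hg : ContDiff ℝ ∞ g) :
    IsVertex g p ↔ fderiv ℝ g p ≠ 0 ∧ vertexFun g p = 0 := by
  constructor
  · rintro ⟨hp, γ, hγ, h⟩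
    exact ⟨hp, (hγ.deriv_planeCurvature_eq_zero_iff hg hp).1 h⟩
  · rintro ⟨hp, h⟩
    obtain ⟨γ, hγ⟩ := exists_isLevelParam hg hp
    exact ⟨hp, γ, hγ, (hγ.deriv_planeCurvature_eq_zero_iff hg hp).2 h⟩

theorem isInflexion_iff (hg : ContDiff ℝ ∞ g) :
    IsInflexion g p ↔ fderiv ℝ g p ≠ 0 ∧ inflexionFun g p = 0 := by
  constructor
  · rintro ⟨hp, γ, hγ, h⟩
    exact ⟨hp, (hγ.planeCurvature_eq_zero_iff hg hp).1 h⟩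
  · rintro ⟨hp, h⟩
    obtain ⟨γ, hγ⟩ := exists_isLevelParam hg hp
    exact ⟨hp, γ, hγ, (hγ.planeCurvature_eq_zero_iff hg hp).2 h⟩

end Curvature

/-! ### Splitting and zero counts for both signs of the level. -/

/-- On the level sets `g = s * k`, for small `k > 0`, in small squares: they are nonsingular, and the
two half-planes `π > 0` and `π < 0` each contain one branch. -/
def LevelSplit (g : ℝ × ℝ → ℝ) (s : ℝ) (π : ℝ × ℝ → ℝ) : Prop :=
  ∀ᶠ r in 𝓝[>] (0 : ℝ), ∀ᶠ k in 𝓝[>] (0 : ℝ),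
    (∀ p ∈ Ioo (-r) r ×ˢ Ioo (-r) r, g p = s * k → fderiv ℝ g p ≠ 0 ∧ π p ≠ 0) ∧
    (IsPreconnected {p | p ∈ Ioo (-r) r ×ˢ Ioo (-r) r ∧ g p = s * k ∧ 0 < π p} ∧
      {p | p ∈ Ioo (-r) r ×ˢ Ioo (-r) r ∧ g p = s * k ∧ 0 < π p}.Nonempty) ∧
    (IsPreconnected {p | p ∈ Ioo (-r) r ×ˢ Ioo (-r) r ∧ g p = s * k ∧ π p < 0} ∧
      {p | p ∈ Ioo (-r) r ×ˢ Ioo (-r) r ∧ g p = s * k ∧ π p < 0}.Nonempty)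

/-- On the level sets `g = s * k`, for small `k > 0`, there are `n` zeros of `P` in the half-plane
`π > 0` and `m` in the half-plane `π < 0`, near the origin. -/
def ZeroCount (g P : ℝ × ℝ → ℝ) (s : ℝ) (π : ℝ × ℝ → ℝ) (n m : ℕ) : Prop :=
  ∃ N ∈ 𝓝 ((0, 0) : ℝ × ℝ), ∀ U ∈ 𝓝 ((0, 0) : ℝ × ℝ), U ⊆ N → ∀ᶠ k in 𝓝[>] (0 : ℝ),
    {p ∈ U | 0 < π p ∧ g p = s * k ∧ P p = 0}.encard = n ∧
    {p ∈ U | π p < 0 ∧ g p = s * k ∧ P p = 0}.encard = m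

theorem IsSaddleJet.levelSplit {g : ℝ × ℝ → ℝ} {β τ : ℝ} (H : IsSaddleJet g β τ) (hβ : 0 < β)
    (hτ : 0 < τ) : LevelSplit g 1 Prod.fst := by
  simpa only [LevelSplit, one_mul] using H.eventually_level hβ hτ

theorem LevelSplit.of_swapNeg {g : ℝ × ℝ → ℝ} (H : LevelSplit (swapNeg g) 1 Prod.fst) :
    LevelSplit g (-1) Prod.snd := by
  filter_upwards [H] with r hr
  filter_upwards [hr] with k ⟨h1, h2, h3⟩
  have hcont : Continuous (Prod.swap : ℝ × ℝ → ℝ × ℝ) := continuous_swap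
  have himg : ∀ Q : ℝ → Prop, {p : ℝ × ℝ | p ∈ Ioo (-r) r ×ˢ Ioo (-r) r ∧ g p = -1 * k ∧ Q p.2} =
      Prod.swap '' {p | p ∈ Ioo (-r) r ×ˢ Ioo (-r) r ∧ swapNeg g p = 1 * k ∧ Q p.1} := by
    intro Q
    rw [image_swap_eq_preimage_swap]
    ext ⟨x, y⟩
    simp only [swapNeg, mem_ofPred_eq, mem_preimage, mem_prod, Prod.swap_prod_mk]
    rw [neg_eq_iff_eq_neg]
    constructor
    · rintro ⟨⟨hx, hy⟩, h, hq⟩; exact ⟨⟨hy, hx⟩, by linarith, hq⟩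
    · rintro ⟨⟨hx, hy⟩, h, hq⟩; exact ⟨⟨hy, hx⟩, by linarith, hq⟩
  refine ⟨?_, ?_, ?_⟩
  · rintro p hp he
    obtain ⟨hd, hne⟩ := h1 p.swap ⟨hp.2, hp.1⟩ (by simp [swapNeg, he])
    refine ⟨fun h0 => hd ?_, hne⟩
    ext <;> simp [fderiv_swapNeg, h0]
  · rw [himg (0 < ·)]
    exact ⟨h2.1.image _ hcont.continuousOn, h2.2.image _⟩
  · rw [himg (· < 0)]
    exact ⟨h3.1.image _ hcont.continuousOn, h3.2.image _⟩

theorem ZeroCount.of_swapNeg {g P P' : ℝ × ℝ → ℝ} {n m : ℕ}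
    (H : ZeroCount (swapNeg g) P' 1 Prod.fst n m) (hP : ∀ p, P' p = -P p.swap) :
    ZeroCount g P (-1) Prod.snd n m := by
  have hlim : Tendsto (Prod.swap : ℝ × ℝ → ℝ × ℝ) (𝓝 (0, 0)) (𝓝 (0, 0)) :=
    continuous_swap.tendsto' _ _ rfl
  obtain ⟨N, hN, HN⟩ := H
  refine ⟨Prod.swap ⁻¹' N, hlim hN, fun U hU hUN => ?_⟩
  filter_upwards [HN (Prod.swap ⁻¹' U) (hlim hU) (fun p hp => by simpa using hUN hp)]
    with k ⟨h1, h2⟩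
  have himg : ∀ Q : ℝ → Prop, {p ∈ U | Q p.2 ∧ g p = -1 * k ∧ P p = 0} =
      Prod.swap '' {p ∈ Prod.swap ⁻¹' U | Q p.1 ∧ swapNeg g p = 1 * k ∧ P' p = 0} := by
    intro Q
    rw [image_swap_eq_preimage_swap]
    ext ⟨x, y⟩
    simp only [hP, swapNeg, mem_ofPred_eq, mem_preimage, Prod.swap_prod_mk]
    rw [neg_eq_iff_eq_neg, neg_eq_zero]
    constructor
    · rintro ⟨h, hq, h', h''⟩; exact ⟨h, hq, by linarith, h''⟩
    · rintro ⟨h, hq, h', h''⟩; exact ⟨h, hq, by linarith, h''⟩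
  rw [himg (0 < ·), himg (· < 0), Prod.swap_injective.encard_image, Prod.swap_injective.encard_image]
  exact ⟨h1, h2⟩

theorem IsBranchedChart.zeroCount {g P F W : ℝ × ℝ → ℝ} {m : ℕ} {M σ : ℝ} {Z : Finset ℝ}
    {c : ℝ → ℝ} (H : IsBranchedChart g P F W m M σ Z c) :
    ZeroCount g P 1 Prod.fst (Z.filter (0 < c ·)).card (Z.filter (0 < σ * c ·)).card := by
  obtain ⟨N, hN, h⟩ := H.encard_eq
  obtain ⟨N', hN', h'⟩ := H.encard_eq_neg
  refine ⟨N ∩ N', inter_mem hN hN', fun U hU hUN => ?_⟩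
  filter_upwards [h U hU (hUN.trans inter_subset_left), h' U hU (hUN.trans inter_subset_right)]
    with k h1 h2
  rw [one_mul]
  exact ⟨h1, h2⟩

/-- The indicator of positivity. -/
noncomputable def posInd (x : ℝ) : ℕ := if 0 < x then 1 else 0

theorem posInd_of_pos {x : ℝ} (h : 0 < x) : posInd x = 1 := if_pos h

theorem posInd_of_neg {x : ℝ} (h : x < 0) : posInd x = 0 := if_neg h.not_gt

theorem posInd_mul {c : ℝ} (hc : 0 < c) (x : ℝ) : posInd (c * x) = posInd x := by
  simp [posInd, hc]

theorem IsSaddleJet.zeroCount_vertexFun {g : ℝ × ℝ → ℝ} {β τ : ℝ} (H : IsSaddleJet g β τ)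
    (hβ : 0 < β) (hτ : 0 < τ) (h1 : vertexCoeff g β τ ≠ 0) (h2 : vertexCoeff g β (-τ) ≠ 0) :
    ZeroCount g (vertexFun g) 1 Prod.fst
      (1 + posInd (vertexCoeff g β τ) + posInd (vertexCoeff g β (-τ)))
      (1 + posInd (vertexCoeff g β τ) + posInd (vertexCoeff g β (-τ))) := by
  obtain ⟨F, W, hc⟩ := H.exists_vertexChart hβ hτ h1 h2
  have hτ' : τ ≠ -τ := by linarith
  have hd : ∀ z : ℝ, z ≠ 0 → ∀ v : ℝ, 0 < v / (4 * β * z ^ 2 * (1 + z ^ 2)) ↔ 0 < v := fun z hz v =>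
    div_pos_iff_of_pos_right (by positivity)
  have hb : 0 < β * τ ^ 2 := by positivity
  have := hc.zeroCount
  simp only [one_mul] at this
  rw [Finset.card_filter, Finset.sum_insert (by simp [hτ.ne, hτ.ne']),
    Finset.sum_insert (by simpa using hτ'), Finset.sum_singleton] at this
  simp only [if_true, hτ.ne', neg_eq_zero, if_false, hd τ hτ.ne', hd (-τ) (neg_ne_zero.2 hτ.ne'),
    hb] at this
  simpa only [posInd, add_assoc] using this

theorem IsSaddleJet.zeroCount_inflexionFun {g : ℝ × ℝ → ℝ} {β τ : ℝ} (H : IsSaddleJet g β τ)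
    (hβ : 0 < β) (hτ : 0 < τ) {d : ℝ → ℝ}
    (hd : ∀ s, d s = taylorCoeff g 3 0 + taylorCoeff g 2 1 * s + taylorCoeff g 1 2 * s ^ 2 +
          taylorCoeff g 0 3 * s ^ 3) (h1 : d τ ≠ 0) (h2 : d (-τ) ≠ 0) :
    ZeroCount g (inflexionFun g) 1 Prod.fst (posInd (d τ) + posInd (d (-τ)))
      (posInd (-d τ) + posInd (-d (-τ))) := by
  obtain ⟨F, W, hc⟩ := H.exists_inflexionChart hβ hτ hd h1 h2
  have hτ' : τ ≠ -τ := by linarith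
  have := hc.zeroCount
  rw [Finset.card_filter, Finset.card_filter, Finset.sum_insert (by simpa using hτ'),
    Finset.sum_insert (by simpa using hτ'), Finset.sum_singleton, Finset.sum_singleton] at this
  simpa only [posInd, neg_one_mul] using this

/-! ### Dependence on the germ only. -/

section Congruence

variable {f g : ℝ × ℝ → ℝ} {p : ℝ × ℝ}

theorem dX_congr (h : f =ᶠ[𝓝 p] g) : dX f =ᶠ[𝓝 p] dX g := by
  filter_upwards [h.fderiv (𝕜 := ℝ)] with q hq
  simp [dX, hq]

theorem dY_congr (h : f =ᶠ[𝓝 p] g) : dY f =ᶠ[𝓝 p] dY g := by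
  filter_upwards [h.fderiv (𝕜 := ℝ)] with q hq
  simp [dY, hq]

theorem taylorCoeff_congr (h : f =ᶠ[𝓝 (0, 0)] g) : taylorCoeff f = taylorCoeff g := by
  funext i j
  have hY : ∀ n, dY^[n] f =ᶠ[𝓝 (0, 0)] dY^[n] g := fun n => by
    induction n with
    | zero => exact h
    | succ n ih => simpa only [Function.iterate_succ_apply'] using dY_congr ih
  have hX : ∀ n, dX^[n] (dY^[j] f) =ᶠ[𝓝 (0, 0)] dX^[n] (dY^[j] g) := fun n => by
    induction n with
    | zero => exact hY j
    | succ n ih => simpa only [Function.iterate_succ_apply'] using dX_congr ih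
  rw [taylorCoeff, taylorCoeff, (hX i).eq_of_nhds]

theorem SurfaceSections.IsLevelParam.congr {γ : ℝ → ℝ × ℝ} (hγ : IsLevelParam f p γ)
    (h : f =ᶠ[𝓝 p] g) : IsLevelParam g p γ := by
  obtain ⟨h1, h2, h3, h4⟩ := hγ
  refine ⟨h1, h2, h3, ?_⟩
  have hc : Tendsto γ (𝓝 0) (𝓝 p) := by
    have := h1.continuousAt.tendsto
    rwa [h2] at this
  filter_upwards [h4, hc.eventually h] with t ht ht'
  rw [← ht', ht, h.eq_of_nhds]

theorem isVertex_congr (h : f =ᶠ[𝓝 p] g) : IsVertex f p ↔ IsVertex g p := by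
  rw [IsVertex, IsVertex, h.fderiv_eq]
  exact and_congr_right fun _ => exists_congr fun γ =>
    and_congr_left fun _ => ⟨fun H => H.congr h, fun H => H.congr h.symm⟩

theorem isInflexion_congr (h : f =ᶠ[𝓝 p] g) : IsInflexion f p ↔ IsInflexion g p := by
  rw [IsInflexion, IsInflexion, h.fderiv_eq]
  exact and_congr_right fun _ => exists_congr fun γ =>
    and_congr_left fun _ => ⟨fun H => H.congr h, fun H => H.congr h.symm⟩

end Congruence

/-- Multiplication by a bump function supported inside `Ω`, equal to `1` near `p`. -/
theorem exists_contDiff_eventuallyEq {f : ℝ × ℝ → ℝ} {Ω : Set (ℝ × ℝ)} (hΩ : IsOpen Ω)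
    {p : ℝ × ℝ} (hp : p ∈ Ω) (hf : ContDiffOn ℝ ∞ f Ω) :
    ∃ g : ℝ × ℝ → ℝ, ContDiff ℝ ∞ g ∧ f =ᶠ[𝓝 p] g := by
  obtain ⟨ε, hε, hεΩ⟩ := Metric.nhds_basis_closedBall.mem_iff.1 (hΩ.mem_nhds hp)
  let b : ContDiffBump p := ⟨ε / 2, ε, by linarith, by linarith⟩
  refine ⟨fun q => b q * f q, contDiff_iff_contDiffAt.2 fun q => ?_, ?_⟩
  · by_cases hq : q ∈ Ω
    · exact b.contDiffAt.mul (hf.contDiffAt (hΩ.mem_nhds hq))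
    · have hq' : q ∉ tsupport b := fun h => hq (hεΩ (by rwa [b.tsupport_eq] at h))
      refine (contDiffAt_const (c := (0 : ℝ))).congr_of_eventuallyEq ?_
      filter_upwards [notMem_tsupport_iff_eventuallyEq.1 hq'] with q hq
      simp [hq]
  · filter_upwards [b.eventuallyEq_one] with q hq
    simp [hq]

/-! ### From half-planes to connected components and transitions. -/

/-- The function `π` has no zero on the level, so a connected subset lies on one side of it. As each
side is connected and nonempty, the sides are precisely the components. -/
theorem hasTwoBranches_of_split {f π : ℝ × ℝ → ℝ} {U₀ : Set (ℝ × ℝ)} {κ : ℝ} (hπ : Continuous π)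
    (h1 : ∀ p ∈ U₀, f p = κ → fderiv ℝ f p ≠ 0 ∧ π p ≠ 0)
    (h2 : IsPreconnected {p | p ∈ U₀ ∧ f p = κ ∧ 0 < π p} ∧
      {p | p ∈ U₀ ∧ f p = κ ∧ 0 < π p}.Nonempty)
    (h3 : IsPreconnected {p | p ∈ U₀ ∧ f p = κ ∧ π p < 0} ∧
      {p | p ∈ U₀ ∧ f p = κ ∧ π p < 0}.Nonempty) :
    HasTwoBranches f U₀ κ {p | p ∈ U₀ ∧ f p = κ ∧ 0 < π p} {p | p ∈ U₀ ∧ f p = κ ∧ π p < 0} := by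
  have hopos : IsOpen {p | 0 < π p} := isOpen_lt continuous_const hπ
  have honeg : IsOpen {p | π p < 0} := isOpen_lt hπ continuous_const
  have hdisj : ∀ K ⊆ {q | q ∈ U₀ ∧ f q = κ}, IsPreconnected K →
      ¬((K ∩ {p | 0 < π p}).Nonempty ∧ (K ∩ {p | π p < 0}).Nonempty) := by
    rintro K hK hpre ⟨ha, hb⟩
    obtain ⟨q, -, hq1, hq2⟩ := hpre _ _ hopos honeg (fun q hq => by
      rcases lt_or_gt_of_ne (h1 q (hK hq).1 (hK hq).2).2 with h | h
      · exact Or.inr h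
      · exact Or.inl h) ha hb
    exact lt_asymm (show 0 < π q from hq1) hq2
  have hpos : ∀ p ∈ {p | p ∈ U₀ ∧ f p = κ ∧ 0 < π p},
      connectedComponentIn {q | q ∈ U₀ ∧ f q = κ} p = {p | p ∈ U₀ ∧ f p = κ ∧ 0 < π p} := by
    intro p hp
    have hpS : p ∈ {q | q ∈ U₀ ∧ f q = κ} := ⟨hp.1, hp.2.1⟩
    refine Subset.antisymm (fun q hq => ?_)
      (h2.1.subset_connectedComponentIn hp fun q hq => ⟨hq.1, hq.2.1⟩)
    have hqS := connectedComponentIn_subset _ _ hq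
    rcases lt_or_gt_of_ne (h1 q hqS.1 hqS.2).2 with h | h
    · exact absurd ⟨⟨p, mem_connectedComponentIn hpS, hp.2.2⟩, ⟨q, hq, h⟩⟩
        (hdisj _ (connectedComponentIn_subset _ _) isPreconnected_connectedComponentIn)
    · exact ⟨hqS.1, hqS.2, h⟩
  have hneg : ∀ p ∈ {p | p ∈ U₀ ∧ f p = κ ∧ π p < 0},
      connectedComponentIn {q | q ∈ U₀ ∧ f q = κ} p = {p | p ∈ U₀ ∧ f p = κ ∧ π p < 0} := by
    intro p hp
    have hpS : p ∈ {q | q ∈ U₀ ∧ f q = κ} := ⟨hp.1, hp.2.1⟩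
    refine Subset.antisymm (fun q hq => ?_)
      (h3.1.subset_connectedComponentIn hp fun q hq => ⟨hq.1, hq.2.1⟩)
    have hqS := connectedComponentIn_subset _ _ hq
    rcases lt_or_gt_of_ne (h1 q hqS.1 hqS.2).2 with h | h
    · exact ⟨hqS.1, hqS.2, h⟩
    · exact absurd ⟨⟨q, hq, h⟩, ⟨p, mem_connectedComponentIn hpS, hp.2.2⟩⟩
        (hdisj _ (connectedComponentIn_subset _ _) isPreconnected_connectedComponentIn)
  obtain ⟨u, hu⟩ := h2.2
  obtain ⟨v, hv⟩ := h3.2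
  refine ⟨fun p hp he => (h1 p hp he).1, fun he => ?_, ?_⟩
  · have : u ∈ {p | p ∈ U₀ ∧ f p = κ ∧ π p < 0} := he ▸ hu
    exact lt_asymm hu.2.2 this.2.2
  · ext K
    constructor
    · rintro ⟨p, hp, rfl⟩
      rcases lt_or_gt_of_ne (h1 p hp.1 hp.2).2 with h | h
      · exact Or.inr (hneg p ⟨hp.1, hp.2, h⟩)
      · exact Or.inl (hpos p ⟨hp.1, hp.2, h⟩)
    · rintro (rfl | rfl)
      · exact ⟨u, ⟨hu.1, hu.2.1⟩, (hpos u hu).symm⟩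
      · exact ⟨v, ⟨hv.1, hv.2.1⟩, (hneg v hv).symm⟩

/-- In small squares, the two branches of the level sets `f = s * k`, for small `k > 0`, are in
pattern `A`. -/
def HasPattern (f : ℝ × ℝ → ℝ) (s : ℝ) (A : Set (ℝ × ℝ) → Set (ℝ × ℝ) → Prop) : Prop :=
  ∀ᶠ r in 𝓝[>] (0 : ℝ), ∀ U ⊆ Ioo (-r) r ×ˢ Ioo (-r) r, IsOpen U → (0, 0) ∈ U →
    ∀ᶠ k in 𝓝[>] (0 : ℝ), ∃ C D,
      HasTwoBranches f (Ioo (-r) r ×ˢ Ioo (-r) r) (s * k) C D ∧ A (C ∩ U) (D ∩ U)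

theorem HasPattern.symm {f : ℝ × ℝ → ℝ} {s : ℝ} {A B : Set (ℝ × ℝ) → Set (ℝ × ℝ) → Prop}
    (H : HasPattern f s A) (h : ∀ X Y, A X Y → B Y X) : HasPattern f s B := by
  filter_upwards [H] with r hr U hU hUo hU0
  filter_upwards [hr U hU hUo hU0] with k ⟨C, D, ⟨h1, h2, h3⟩, hA⟩
  exact ⟨D, C, ⟨h1, h2.symm, by rw [h3, pair_comm]⟩, h _ _ hA⟩

theorem eventually_square_subset {W : Set (ℝ × ℝ)} (hW : W ∈ 𝓝 ((0, 0) : ℝ × ℝ)) :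
    ∀ᶠ r in 𝓝[>] (0 : ℝ), Ioo (-r) r ×ˢ Ioo (-r) r ⊆ W := by
  obtain ⟨ε, hε, h⟩ := Metric.mem_nhds_iff.1 hW
  filter_upwards [Ioo_mem_nhdsGT hε] with r hr p hp
  refine h ?_
  rw [Metric.mem_ball, Prod.dist_eq, max_lt_iff, Real.dist_eq, Real.dist_eq, sub_zero, sub_zero]
  exact ⟨(abs_lt.2 hp.1).trans hr.2, (abs_lt.2 hp.2).trans hr.2⟩

/-- All requirements hold for every small `r`, so a single square serves both signs of the level and
the given neighbourhood. -/
theorem transition_of_hasPattern {f : ℝ × ℝ → ℝ} {σ : ℝ}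
    {A B : Set (ℝ × ℝ) → Set (ℝ × ℝ) → Prop} (hσ : σ = 1 ∨ σ = -1) (hA : HasPattern f σ A)
    (hB : HasPattern f (-σ) B) : Transition f A B := by
  refine ⟨σ, hσ, fun W hW => ?_⟩
  obtain ⟨r, ⟨⟨h1, h2⟩, h3⟩, hr⟩ := (((hA.and hB).and (eventually_square_subset hW)).and
    self_mem_nhdsWithin).exists
  have hr' : (0 : ℝ) < r := hr
  refine ⟨_, h3, isOpen_Ioo.prod isOpen_Ioo, ⟨⟨by linarith, hr'⟩, ⟨by linarith, hr'⟩⟩,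
    fun U hU hUo hU0 => ?_⟩
  obtain ⟨ε, hε, h⟩ := mem_nhdsGT_iff_exists_Ioc_subset.1 ((h1 U hU hUo hU0).and (h2 U hU hUo hU0))
  exact ⟨ε, hε, fun k hk hkε => h ⟨hk, hkε⟩⟩

section Patterns

variable {f g π : ℝ × ℝ → ℝ} {s : ℝ} {n m n' m' : ℕ}

theorem hasPattern_of_levelSplit (hfg : f =ᶠ[𝓝 (0, 0)] g) (hπ : Continuous π)
    (hL : LevelSplit g s π) {A : Set (ℝ × ℝ) → Set (ℝ × ℝ) → Prop}
    (hA : ∃ N ∈ 𝓝 ((0, 0) : ℝ × ℝ), ∀ U ∈ 𝓝 ((0, 0) : ℝ × ℝ), U ⊆ N → ∀ᶠ k in 𝓝[>] (0 : ℝ),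
      (∀ p ∈ U, g p = s * k → fderiv ℝ g p ≠ 0) →
        A {p ∈ U | 0 < π p ∧ g p = s * k} {p ∈ U | π p < 0 ∧ g p = s * k}) :
    HasPattern f s A := by
  obtain ⟨N, hN, hA⟩ := hA
  filter_upwards [hL, eventually_square_subset hN,
    eventually_square_subset (eventually_eventually_nhds.2 hfg)] with r hr hrN hrfg U hU hUo hU0
  have heq : ∀ p ∈ Ioo (-r) r ×ˢ Ioo (-r) r, f p = g p := fun p hp =>
    (show f =ᶠ[𝓝 p] g from hrfg hp).eq_of_nhds
  have hd : ∀ p ∈ Ioo (-r) r ×ˢ Ioo (-r) r, fderiv ℝ f p = fderiv ℝ g p := fun p hp =>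
    (show f =ᶠ[𝓝 p] g from hrfg hp).fderiv_eq
  filter_upwards [hr, hA U (hUo.mem_nhds hU0) (hU.trans hrN)] with k ⟨h1, h2, h3⟩ hk
  have hset : ∀ Q : ℝ → Prop, {p | p ∈ Ioo (-r) r ×ˢ Ioo (-r) r ∧ f p = s * k ∧ Q (π p)} =
      {p | p ∈ Ioo (-r) r ×ˢ Ioo (-r) r ∧ g p = s * k ∧ Q (π p)} := fun Q => by
    ext p
    exact and_congr_right fun hp => by rw [heq p hp]
  refine ⟨_, _, hasTwoBranches_of_split hπ (fun p hp he => ?_) ?_ ?_, ?_⟩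
  · rw [hd p hp]
    exact h1 p hp (by rwa [← heq p hp])
  · rwa [hset (0 < ·)]
  · rwa [hset (· < 0)]
  · have hinter : ∀ Q : ℝ → Prop, {p | p ∈ Ioo (-r) r ×ˢ Ioo (-r) r ∧ f p = s * k ∧ Q (π p)} ∩ U =
        {p ∈ U | Q (π p) ∧ g p = s * k} := fun Q => by
      rw [hset Q]
      ext p
      constructor
      · rintro ⟨⟨-, h, h'⟩, hp⟩; exact ⟨hp, h', h⟩
      · rintro ⟨hp, h', h⟩; exact ⟨⟨hU hp, h, h'⟩, hp⟩
    rw [hinter (0 < ·), hinter (· < 0)]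
    exact hk fun p hp he => (h1 p (hU hp) he).1

theorem ZeroCount.exists_counts {P : ℝ × ℝ → ℝ} {R : ℝ × ℝ → Prop} (hP : ZeroCount g P s π n m)
    (hR : ∀ᶠ p in 𝓝 ((0, 0) : ℝ × ℝ), fderiv ℝ g p ≠ 0 → (R p ↔ P p = 0)) :
    ∃ N ∈ 𝓝 ((0, 0) : ℝ × ℝ), ∀ U ∈ 𝓝 ((0, 0) : ℝ × ℝ), U ⊆ N → ∀ᶠ k in 𝓝[>] (0 : ℝ),
      (∀ p ∈ U, g p = s * k → fderiv ℝ g p ≠ 0) →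
        Counts R n m {p ∈ U | 0 < π p ∧ g p = s * k} {p ∈ U | π p < 0 ∧ g p = s * k} := by
  obtain ⟨N, hN, h⟩ := hP
  refine ⟨N ∩ _, inter_mem hN hR, fun U hU hUN => ?_⟩
  filter_upwards [h U hU (hUN.trans inter_subset_left)] with k ⟨h1, h2⟩ hk
  have hset : ∀ Q : ℝ → Prop, {p ∈ {p ∈ U | Q (π p) ∧ g p = s * k} | R p} =
      {p ∈ U | Q (π p) ∧ g p = s * k ∧ P p = 0} := fun Q => by
    ext p
    constructor
    · rintro ⟨⟨hp, hq, he⟩, hRp⟩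
      exact ⟨hp, hq, he, ((hUN hp).2 (hk p hp he)).1 hRp⟩
    · rintro ⟨hp, hq, he, hPp⟩
      exact ⟨⟨hp, hq, he⟩, ((hUN hp).2 (hk p hp he)).2 hPp⟩
  rw [Counts, hset (0 < ·), hset (· < 0)]
  exact ⟨h1, h2⟩

theorem eventually_isVertex_iff (hfg : f =ᶠ[𝓝 (0, 0)] g) (hg : ContDiff ℝ ∞ g) :
    ∀ᶠ p in 𝓝 ((0, 0) : ℝ × ℝ), fderiv ℝ g p ≠ 0 → (IsVertex f p ↔ vertexFun g p = 0) := by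
  filter_upwards [eventually_eventually_nhds.2 hfg] with p hp hd
  rw [isVertex_congr hp, isVertex_iff hg, and_iff_right hd]

theorem eventually_isInflexion_iff (hfg : f =ᶠ[𝓝 (0, 0)] g) (hg : ContDiff ℝ ∞ g) :
    ∀ᶠ p in 𝓝 ((0, 0) : ℝ × ℝ), fderiv ℝ g p ≠ 0 → (IsInflexion f p ↔ inflexionFun g p = 0) := by
  filter_upwards [eventually_eventually_nhds.2 hfg] with p hp hd
  rw [isInflexion_congr hp, isInflexion_iff hg, and_iff_right hd]

theorem hasPattern_vertex (hfg : f =ᶠ[𝓝 (0, 0)] g) (hg : ContDiff ℝ ∞ g) (hπ : Continuous π)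
    (hL : LevelSplit g s π) (hV : ZeroCount g (vertexFun g) s π n m) :
    HasPattern f s (Counts (IsVertex f) n m) :=
  hasPattern_of_levelSplit hfg hπ hL (hV.exists_counts (eventually_isVertex_iff hfg hg))

theorem hasPattern_vertex_inflexion (hfg : f =ᶠ[𝓝 (0, 0)] g) (hg : ContDiff ℝ ∞ g)
    (hπ : Continuous π) (hL : LevelSplit g s π) (hV : ZeroCount g (vertexFun g) s π n m)
    (hI : ZeroCount g (inflexionFun g) s π n' m') :
    HasPattern f s (fun X Y => Counts (IsVertex f) n m X Y ∧ Counts (IsInflexion f) n' m' X Y) := by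
  obtain ⟨N, hN, h⟩ := hV.exists_counts (eventually_isVertex_iff hfg hg)
  obtain ⟨N', hN', h'⟩ := hI.exists_counts (eventually_isInflexion_iff hfg hg)
  refine hasPattern_of_levelSplit hfg hπ hL ⟨N ∩ N', inter_mem hN hN', fun U hU hUN => ?_⟩
  filter_upwards [h U hU (hUN.trans inter_subset_left), h' U hU (hUN.trans inter_subset_right)]
    with k h1 h2 hk
  exact ⟨h1 hk, h2 hk⟩

end Patterns

/-! ### Leading coefficients in terms of `L` and the cubic part. -/

theorem homPart_three (f : ℝ × ℝ → ℝ) (s : ℝ) : homPart f 3 s = taylorCoeff f 0 3 +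
    taylorCoeff f 1 2 * s + taylorCoeff f 2 1 * s ^ 2 + taylorCoeff f 3 0 * s ^ 3 := by
  simp [homPart, Finset.sum_range_succ]

theorem homPart_four (f : ℝ × ℝ → ℝ) (s : ℝ) : homPart f 4 s = taylorCoeff f 0 4 +
    taylorCoeff f 1 3 * s + taylorCoeff f 2 2 * s ^ 2 + taylorCoeff f 3 1 * s ^ 3 +
    taylorCoeff f 4 0 * s ^ 4 := by
  simp [homPart, Finset.sum_range_succ]

/-- The direction `x = s * y` has slope `s⁻¹` in the chart, and rescaling `(1, s⁻¹)` to `(s, 1)`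
costs a negative power of `s`. Its exponent is even, so `L` determines the sign. -/
theorem vertexCoeff_inv (g : ℝ × ℝ → ℝ) {a s : ℝ} (ha : 0 < a) (hs : s ^ 2 = a ^ 2) :
    vertexCoeff g (a ^ 2) s⁻¹ = (s ^ 8)⁻¹ * contactExpr g s := by
  have hs0 : s ≠ 0 := by
    intro h
    rw [h] at hs
    have : 0 < a ^ 2 := by positivity
    simp at hs; exact this.ne hs
  rw [vertexCoeff, contactExpr, homPart_three, homPart_four, ← hs]
  field_simp
  ring

/-- After the exchange of axes the slope is `s` itself. The minus sign is the reason why negative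
levels gain vertices from negative values of `L`. -/
theorem vertexCoeff_swapNeg {g : ℝ × ℝ → ℝ} (hg : ContDiff ℝ ∞ g) (s : ℝ) :
    vertexCoeff (swapNeg g) 1 s = -contactExpr g s := by
  simp only [vertexCoeff, contactExpr, homPart_three, homPart_four, taylorCoeff_swapNeg hg]
  ring

section Main

variable {f g : ℝ × ℝ → ℝ} {a : ℝ}

theorem SurfaceSections.IsHyperbolicMonge.isSaddleJet (H : IsHyperbolicMonge f a)
    (hc : taylorCoeff f = taylorCoeff g) (hg : ContDiff ℝ ∞ g) : IsSaddleJet g (a ^ 2) a⁻¹ := by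
  obtain ⟨ha, h00, h10, h01, h20, h11, h02⟩ := H
  rw [hc] at *
  exact ⟨hg, h00, h10, h01, by rw [h20]; field_simp, h11, h02⟩

theorem IsSaddleJet.swapNeg_one (H : IsSaddleJet g (a ^ 2) a⁻¹) (ha : 0 < a) :
    IsSaddleJet (_root_.swapNeg g) 1 a := by
  have := H.swapNeg (inv_pos.2 ha)
  rwa [inv_inv, inv_pow, mul_inv_cancel₀ (by positivity)] at this

theorem IsSaddleJet.zeroCount_vertexFun_pos (H : IsSaddleJet g (a ^ 2) a⁻¹) (ha : 0 < a)
    (h1 : contactExpr g a ≠ 0) (h2 : contactExpr g (-a) ≠ 0) :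
    ZeroCount g (vertexFun g) 1 Prod.fst
      (1 + posInd (contactExpr g a) + posInd (contactExpr g (-a)))
      (1 + posInd (contactExpr g a) + posInd (contactExpr g (-a))) := by
  have e1 := vertexCoeff_inv g ha (s := a) rfl
  have e2 := vertexCoeff_inv g ha (s := -a) (neg_sq a)
  rw [inv_neg] at e2
  have hpos : ∀ s : ℝ, s ≠ 0 → 0 < (s ^ 8)⁻¹ := fun s hs => by positivity
  have p1 := hpos a ha.ne'
  have p2 := hpos (-a) (neg_ne_zero.2 ha.ne')
  have := H.zeroCount_vertexFun (by positivity) (inv_pos.2 ha)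
    (by rw [e1]; exact mul_ne_zero p1.ne' h1) (by rw [e2]; exact mul_ne_zero p2.ne' h2)
  rwa [e1, e2, posInd_mul p1, posInd_mul p2] at this

theorem IsSaddleJet.zeroCount_vertexFun_neg (H : IsSaddleJet g (a ^ 2) a⁻¹) (ha : 0 < a)
    (h1 : contactExpr g a ≠ 0) (h2 : contactExpr g (-a) ≠ 0) :
    ZeroCount g (vertexFun g) (-1) Prod.snd
      (1 + posInd (-contactExpr g a) + posInd (-contactExpr g (-a)))
      (1 + posInd (-contactExpr g a) + posInd (-contactExpr g (-a))) := by
  have e1 := vertexCoeff_swapNeg H.contDiff a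
  have e2 := vertexCoeff_swapNeg H.contDiff (-a)
  have := (H.swapNeg_one ha).zeroCount_vertexFun one_pos ha
    (by rw [e1]; exact neg_ne_zero.2 h1) (by rw [e2]; exact neg_ne_zero.2 h2)
  rw [e1, e2] at this
  exact this.of_swapNeg (vertexFun_swapNeg H.contDiff)

/-- The rescaling factor is now `s ^ (-3)`, an odd power, which reverses the sign at `s = -a` but
not at `s = a`. On negative levels, counted in `y > 0` and `y < 0`, no such asymmetry arises. -/
theorem IsSaddleJet.zeroCount_inflexionFun_pos (H : IsSaddleJet g (a ^ 2) a⁻¹) (ha : 0 < a)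
    (h1 : homPart g 3 a ≠ 0) (h2 : homPart g 3 (-a) ≠ 0) :
    ZeroCount g (inflexionFun g) 1 Prod.fst
      (posInd (homPart g 3 a) + posInd (-homPart g 3 (-a)))
      (posInd (-homPart g 3 a) + posInd (homPart g 3 (-a))) := by
  have p : 0 < (a ^ 3)⁻¹ := by positivity
  have e1 : taylorCoeff g 3 0 + taylorCoeff g 2 1 * a⁻¹ + taylorCoeff g 1 2 * a⁻¹ ^ 2 +
      taylorCoeff g 0 3 * a⁻¹ ^ 3 = (a ^ 3)⁻¹ * homPart g 3 a := by
    rw [homPart_three]; field_simp; ring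
  have e2 : taylorCoeff g 3 0 + taylorCoeff g 2 1 * -a⁻¹ + taylorCoeff g 1 2 * (-a⁻¹) ^ 2 +
      taylorCoeff g 0 3 * (-a⁻¹) ^ 3 = (a ^ 3)⁻¹ * -homPart g 3 (-a) := by
    rw [homPart_three]; field_simp; ring
  have := H.zeroCount_inflexionFun (by positivity) (inv_pos.2 ha) (fun s => rfl)
    (by rw [e1]; exact mul_ne_zero p.ne' h1)
    (by rw [e2]; exact mul_ne_zero p.ne' (neg_ne_zero.2 h2))
  rwa [e1, e2, ← mul_neg, ← mul_neg, posInd_mul p, posInd_mul p, posInd_mul p, posInd_mul p,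
    neg_neg] at this

theorem IsSaddleJet.zeroCount_inflexionFun_neg (H : IsSaddleJet g (a ^ 2) a⁻¹) (ha : 0 < a)
    (h1 : homPart g 3 a ≠ 0) (h2 : homPart g 3 (-a) ≠ 0) :
    ZeroCount g (inflexionFun g) (-1) Prod.snd
      (posInd (-homPart g 3 a) + posInd (-homPart g 3 (-a)))
      (posInd (homPart g 3 a) + posInd (homPart g 3 (-a))) := by
  have e : ∀ s, -homPart g 3 s = taylorCoeff (_root_.swapNeg g) 3 0 + taylorCoeff (_root_.swapNeg g) 2 1 * s +
      taylorCoeff (_root_.swapNeg g) 1 2 * s ^ 2 + taylorCoeff (_root_.swapNeg g) 0 3 * s ^ 3 := fun s => by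
    simp only [homPart_three, taylorCoeff_swapNeg H.contDiff]; ring
  have := (H.swapNeg_one ha).zeroCount_inflexionFun one_pos ha e (neg_ne_zero.2 h1)
    (neg_ne_zero.2 h2)
  rw [neg_neg, neg_neg] at this
  exact this.of_swapNeg (inflexionFun_swapNeg H.contDiff)

theorem IsSaddleJet.hasPattern_vertex (H : IsSaddleJet g (a ^ 2) a⁻¹) (hfg : f =ᶠ[𝓝 (0, 0)] g)
    (ha : 0 < a) (h1 : contactExpr g a ≠ 0) (h2 : contactExpr g (-a) ≠ 0) :
    HasPattern f 1 (Counts (IsVertex f)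
      (1 + posInd (contactExpr g a) + posInd (contactExpr g (-a)))
      (1 + posInd (contactExpr g a) + posInd (contactExpr g (-a)))) ∧
    HasPattern f (-1) (Counts (IsVertex f)
      (1 + posInd (-contactExpr g a) + posInd (-contactExpr g (-a)))
      (1 + posInd (-contactExpr g a) + posInd (-contactExpr g (-a)))) :=
  ⟨_root_.hasPattern_vertex hfg H.contDiff continuous_fst
      (H.levelSplit (by positivity) (inv_pos.2 ha)) (H.zeroCount_vertexFun_pos ha h1 h2),
    _root_.hasPattern_vertex hfg H.contDiff continuous_snd
      (((H.swapNeg_one ha).levelSplit one_pos ha).of_swapNeg) (H.zeroCount_vertexFun_neg ha h1 h2)⟩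

theorem IsSaddleJet.hasPattern_vertex_inflexion (H : IsSaddleJet g (a ^ 2) a⁻¹)
    (hfg : f =ᶠ[𝓝 (0, 0)] g) (ha : 0 < a) (h1 : contactExpr g a ≠ 0) (h2 : contactExpr g (-a) ≠ 0)
    (h3 : homPart g 3 a ≠ 0) (h4 : homPart g 3 (-a) ≠ 0) :
    HasPattern f 1 (fun X Y => Counts (IsVertex f)
      (1 + posInd (contactExpr g a) + posInd (contactExpr g (-a)))
      (1 + posInd (contactExpr g a) + posInd (contactExpr g (-a))) X Y ∧
      Counts (IsInflexion f) (posInd (homPart g 3 a) + posInd (-homPart g 3 (-a)))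
        (posInd (-homPart g 3 a) + posInd (homPart g 3 (-a))) X Y) ∧
    HasPattern f (-1) (fun X Y => Counts (IsVertex f)
      (1 + posInd (-contactExpr g a) + posInd (-contactExpr g (-a)))
      (1 + posInd (-contactExpr g a) + posInd (-contactExpr g (-a))) X Y ∧
      Counts (IsInflexion f) (posInd (-homPart g 3 a) + posInd (-homPart g 3 (-a)))
        (posInd (homPart g 3 a) + posInd (homPart g 3 (-a))) X Y) :=
  ⟨_root_.hasPattern_vertex_inflexion hfg H.contDiff continuous_fst
      (H.levelSplit (by positivity) (inv_pos.2 ha)) (H.zeroCount_vertexFun_pos ha h1 h2)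
      (H.zeroCount_inflexionFun_pos ha h3 h4),
    _root_.hasPattern_vertex_inflexion hfg H.contDiff continuous_snd
      (((H.swapNeg_one ha).levelSplit one_pos ha).of_swapNeg) (H.zeroCount_vertexFun_neg ha h1 h2)
      (H.zeroCount_inflexionFun_neg ha h3 h4)⟩

end Main

theorem SurfaceSections.Counts.symm {P : ℝ × ℝ → Prop} {m n : ℕ} {X Y : Set (ℝ × ℝ)} (h : Counts P m n X Y) :
    Counts P n m Y X := ⟨h.2, h.1⟩

/-! ### The transitions. -/

theorem mainTheorem6 (f : ℝ × ℝ → ℝ) (Ω : Set (ℝ × ℝ)) (hΩ : IsOpen Ω)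
    (h0 : ((0, 0) : ℝ × ℝ) ∈ Ω) (hf : ContDiffOn ℝ ∞ f Ω) (a : ℝ)
    (hM : IsHyperbolicMonge f a) (hH : CaseH₁ f a) :
    (contactExpr f a * contactExpr f (-a) < 0 → VertexTransition f 2 2 2 2) ∧
    (0 < contactExpr f a * contactExpr f (-a) → VertexTransition f 1 1 3 3) ∧
    ((contactExpr f a < 0 ∧ contactExpr f (-a) < 0 ∧ 0 < homPart f 3 a * homPart f 3 (-a)) ∨
      (0 < contactExpr f a ∧ 0 < contactExpr f (-a) ∧ homPart f 3 a * homPart f 3 (-a) < 0) →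
      InflexionTransition f 1 1 2 0) ∧
    ((contactExpr f a < 0 ∧ contactExpr f (-a) < 0 ∧ homPart f 3 a * homPart f 3 (-a) < 0) ∨
      (0 < contactExpr f a ∧ 0 < contactExpr f (-a) ∧ 0 < homPart f 3 a * homPart f 3 (-a)) →
      InflexionTransition f 2 0 1 1) := by
  obtain ⟨g, hg, hfg⟩ := exists_contDiff_eventuallyEq hΩ h0 hf
  have hc := taylorCoeff_congr hfg
  have ha : 0 < a := hM.1
  have hS := hM.isSaddleJet hc hg
  have hL : contactExpr f = contactExpr g := by
    funext s; simp only [contactExpr, homPart, hc]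
  have hh : homPart f = homPart g := by
    funext n s; simp only [homPart, hc]
  rw [hL, hh]
  have V := hS.hasPattern_vertex hfg ha
  have I := hS.hasPattern_vertex_inflexion hfg ha
  generalize contactExpr g a = L₁ at V I ⊢
  generalize contactExpr g (-a) = L₂ at V I ⊢
  generalize homPart g 3 a = u at I ⊢
  generalize homPart g 3 (-a) = v at I ⊢
  have ip : ∀ {x : ℝ}, 0 < x → posInd x = 1 ∧ posInd (-x) = 0 := fun h =>
    ⟨posInd_of_pos h, posInd_of_neg (neg_neg_of_pos h)⟩
  have ineg : ∀ {x : ℝ}, x < 0 → posInd x = 0 ∧ posInd (-x) = 1 := fun h =>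
    ⟨posInd_of_neg h, posInd_of_pos (neg_pos_of_neg h)⟩
  have n11 : (- -1 : ℝ) = 1 := neg_neg 1
  -- The half-plane containing the two inflexions depends on the signs of the cubic values. Vertex
  -- counts are equal on the two sides, so the branches may be relabelled.
  have hswap : ∀ {i j : ℕ} (X Y : Set (ℝ × ℝ)), Counts (IsVertex f) i i X Y ∧
      Counts (IsInflexion f) 0 j X Y → Counts (IsVertex f) i i Y X ∧
      Counts (IsInflexion f) j 0 Y X := fun X Y h => ⟨Counts.symm h.1, Counts.symm h.2⟩
  refine ⟨fun h => ?_, fun h => ?_, fun h => ?_, fun h => ?_⟩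
  · rcases mul_neg_iff.1 h with ⟨h1, h2⟩ | ⟨h1, h2⟩
    · obtain ⟨Vp, Vn⟩ := V h1.ne' h2.ne
      simp only [ip h1, ineg h2] at Vp Vn
      exact transition_of_hasPattern (Or.inl rfl) Vp Vn
    · obtain ⟨Vp, Vn⟩ := V h1.ne h2.ne'
      simp only [ineg h1, ip h2] at Vp Vn
      exact transition_of_hasPattern (Or.inl rfl) Vp Vn
  · rcases mul_pos_iff.1 h with ⟨h1, h2⟩ | ⟨h1, h2⟩
    · obtain ⟨Vp, Vn⟩ := V h1.ne' h2.ne'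
      simp only [ip h1, ip h2] at Vp Vn
      -- Both values of `L` are positive: the levels with `1 + 1` vertices are the negative ones,
      -- hence `σ = -1`.
      exact transition_of_hasPattern (Or.inr rfl) Vn (n11.symm ▸ Vp)
    · obtain ⟨Vp, Vn⟩ := V h1.ne h2.ne
      simp only [ineg h1, ineg h2] at Vp Vn
      exact transition_of_hasPattern (Or.inl rfl) Vp Vn
  · rcases h with ⟨h1, h2, h3⟩ | ⟨h1, h2, h3⟩
    · rcases mul_pos_iff.1 h3 with ⟨h4, h5⟩ | ⟨h4, h5⟩
      · obtain ⟨Ip, In⟩ := I h1.ne h2.ne h4.ne' h5.ne'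
        simp only [ineg h1, ineg h2, ip h4, ip h5] at Ip In
        -- Both cubic values are positive, so on negative levels the inflexions occur as `0 + 2`,
        -- with both in `y < 0`.
        exact transition_of_hasPattern (Or.inl rfl) Ip (In.symm hswap)
      · obtain ⟨Ip, In⟩ := I h1.ne h2.ne h4.ne h5.ne
        simp only [ineg h1, ineg h2, ineg h4, ineg h5] at Ip In
        exact transition_of_hasPattern (Or.inl rfl) Ip In
    · rcases mul_neg_iff.1 h3 with ⟨h4, h5⟩ | ⟨h4, h5⟩
      · obtain ⟨Ip, In⟩ := I h1.ne' h2.ne' h4.ne' h5.ne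
        simp only [ip h1, ip h2, ip h4, ineg h5] at Ip In
        exact transition_of_hasPattern (Or.inr rfl) In (n11.symm ▸ Ip)
      · obtain ⟨Ip, In⟩ := I h1.ne' h2.ne' h4.ne h5.ne'
        simp only [ip h1, ip h2, ineg h4, ip h5] at Ip In
        exact transition_of_hasPattern (Or.inr rfl) In (n11.symm ▸ Ip.symm hswap)
  · rcases h with ⟨h1, h2, h3⟩ | ⟨h1, h2, h3⟩
    · rcases mul_neg_iff.1 h3 with ⟨h4, h5⟩ | ⟨h4, h5⟩
      · obtain ⟨Ip, In⟩ := I h1.ne h2.ne h4.ne' h5.ne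
        simp only [ineg h1, ineg h2, ip h4, ineg h5] at Ip In
        exact transition_of_hasPattern (Or.inl rfl) Ip In
      · obtain ⟨Ip, In⟩ := I h1.ne h2.ne h4.ne h5.ne'
        simp only [ineg h1, ineg h2, ineg h4, ip h5] at Ip In
        exact transition_of_hasPattern (Or.inl rfl) (Ip.symm hswap) In
    · rcases mul_pos_iff.1 h3 with ⟨h4, h5⟩ | ⟨h4, h5⟩
      · obtain ⟨Ip, In⟩ := I h1.ne' h2.ne' h4.ne' h5.ne'
        simp only [ip h1, ip h2, ip h4, ip h5] at Ip In
        exact transition_of_hasPattern (Or.inr rfl) (In.symm hswap) (n11.symm ▸ Ip)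
      · obtain ⟨Ip, In⟩ := I h1.ne' h2.ne' h4.ne h5.ne
        simp only [ip h1, ip h2, ineg h4, ineg h5] at Ip In
        exact transition_of_hasPattern (Or.inr rfl) In (n11.symm ▸ Ip)
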